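/- Let $n\ge 0$, let $S_n[\mathbf q]=\{\mathbf q^{\alpha}w : w\in S_n,\ \alpha\in\mathbb Z_{\ge0}^{n-1}\}$, and put $\ell(\mathbf q^\alpha w)=\ell(w)+2\deg\mathbf q^\alpha$, where $\ell(w)$ is the number of inversions of $w$, and $\mathbf q_{ij}=q_iq_{i+1}\cdots q_{j-1}$ for $i<j$. For $k\in[n-1]$ the covers of the quantum $k$-Bruhat order are $\mathbf q^\alpha w\lessdot_k \mathbf q^\alpha w s_{ij}$ and $\mathbf q^\alpha w\lessdot_k \mathbf q^\alpha\mathbf q_{ij} w s_{ij}$ with $i\le k<j$, whenever the length $\ell$ goes up by exactly $1$. Let $\mathcal F_n$ be the free monoid on the operators $\mathbf v_{ab}$ ($a\ne b$ in $[n]$), and let $\mathcal F_n\cup\{\mathbf 0\}$ act on $S_n[\mathbf q]\cup\{0\}$ from the left (the rightmost operator acts first) by $\mathbf 0\bullet_k x=0$, $\mathbf v_{ab}\bullet_k 0=0$ and, for $x=\mathbf q^\alpha w$, by: $\mathbf v_{ab}\bullet_k x=\mathbf q^\alpha s_{ab}w$ if $a<b$ and $x\lessdot_k\mathbf q^\alpha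 s_{ab}w$; $\mathbf v_{ab}\bullet_k x=\mathbf q^\alpha\mathbf q_{ij}s_{ab}w$ if $a>b$, $w(i)=a$, $w(j)=b$, $i<j$ and $x\lessdot_k\mathbf q^\alpha\mathbf q_{ij}s_{ab}w$; and $\mathbf v_{ab}\bullet_kx=0$ otherwise. Write $\mathbf u\equiv\mathbf v$ if $\mathbf u\bullet_kx=\mathbf v\bullet_kx$ for all $x\in S_n[\mathbf q]$ and all $k\in[n-1]$. The degree of a composition $\mathbf v=\mathbf v_{a_rb_r}\cdots\mathbf v_{a_1b_1}$ is $r$, and its support is $\{a_1,b_1,\dots,a_r,b_r\}$. A zero equivalence of degree $d$ is $\mathbf v\equiv\mathbf 0$ with $\mathbf v$ of degree $d$; a non-zero equivalence of degree $d$ is $\mathbf u\equiv\mathbf v\not\equiv\mathbf 0$ with $\mathbf u,\mathbf v$ of degree $d$. It is minimal if it is not a consequence of equivalences of lower degree, that is, if it does not lie in the congruence on the monoid $\mathcal F_n\cup\{\mathbf 0\}$ generated by all equivalences between elements each of which is $\mathbf 0$ or a composition of degree less than $d$. For a composition $\mathbf v=\mathbf v_{a_rb_r}\cdots\mathbf v_{a_1b_1}$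 with support $\{t_1<\dots<t_m\}$ consider the transformations: flattening (replace every index $t_i$ by $i$); cyclic shift (replace $t_i$ by $t_{i+1}$ for $i<m$, and $t_m$ by $t_1$); horizontal flip (replace every $\mathbf v_{ab}$ by $\mathbf v_{\mathfrak h(b)\mathfrak h(a)}$, where $\mathfrak h(t_i)=t_{m+1-i}$); vertical flip ($\mathbf v\mapsto\mathbf v_{a_1b_1}\cdots\mathbf v_{a_rb_r}$). Two compositions are related if they are connected by finitely many of these transformations and their inverses. Two pairs of compositions are related if they are connected in the same way, where every transformation is applied simultaneously to both members of a pair whose members have the same support. Then, up to these transformations, there are exactly one minimal zero equivalence and exactly one minimal non-zero equivalence of degree four: (i) $\mathbf w\equiv\mathbf 0$ is a minimal zero equivalence of degree four if and only if $\mathbf w$ is related to $\mathbf v_{a_3a_5}\mathbf v_{a_2a_3}\mathbf v_{a_1a_2}\mathbf v_{a_4a_1}$ for some $a_1<a_2<a_3<a_4<a_5$ in $[n]$, and all these compositions are related to one another; (ii) $\mathbf u\equiv\mathbf w$ is a minimal non-zero equivalence of degree four if and only if $(\mathbf u,\mathbf w)$ is related to $(\mathbf v_{a_3a_1}\mathbf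 v_{a_2a_3}\mathbf v_{a_1a_2}\mathbf v_{a_4a_1},\ \mathbf v_{a_4a_1}\mathbf v_{a_3a_4}\mathbf v_{a_2a_3}\mathbf v_{a_4a_2})$ for some $a_1<a_2<a_3<a_4$ in $[n]$, and all these pairs are related to one another. -/

import Mathlib

namespace QuantumBruhat

/-- The set `S_n[q]`: the pair `(α, w)` is `q^α w`. Positions and values `1, …, n` are the elements
`0, …, n - 1` of `Fin n`, and the coordinate `l` of `α` is the exponent of `q_{l+1}`. -/
abbrev QPerm (n : ℕ) : Type := (Fin (n - 1) → ℕ) × Equiv.Perm (Fin n)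

/-- The number of inversions of a permutation. -/
def permLength {n : ℕ} (w : Equiv.Perm (Fin n)) : ℕ :=
  (Finset.univ.filter fun p : Fin n × Fin n => p.1 < p.2 ∧ w p.2 < w p.1).card

/-- `ℓ(q^α w) = ℓ(w) + 2 deg q^α`. -/
def qLength {n : ℕ} (x : QPerm n) : ℕ :=
  permLength x.2 + 2 * ∑ l, x.1 l

/-- The exponent vector of `q_{ij} = q_i q_{i+1} ⋯ q_{j-1}` (used for `i < j`). -/
def qExp {n : ℕ} (i j : Fin n) : Fin (n - 1) → ℕ :=
  fun l => if (i : ℕ) ≤ l ∧ (l : ℕ) < j then 1 else 0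

/-- The cover relation of the quantum `k`-Bruhat order on `S_n[q]`: `q^α w` is covered by
`q^α w s_{ij}` and by `q^α q_{ij} w s_{ij}` whenever `i ≤ k < j` (positions counted from one) and
the length goes up by exactly one. -/
def QCover {n : ℕ} (k : ℕ) (x y : QPerm n) : Prop :=
  ∃ i j : Fin n, (i : ℕ) + 1 ≤ k ∧ k < (j : ℕ) + 1 ∧
    (y = (x.1, x.2 * Equiv.swap i j) ∨ y = (x.1 + qExp i j, x.2 * Equiv.swap i j)) ∧
    qLength y = qLength x + 1

instance {n : ℕ} (k : ℕ) (x y : QPerm n) : Decidable (QCover k x y) := by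
  unfold QCover; infer_instance

/-- The generators `v_{ab}`, `a ≠ b`. -/
abbrev Op (n : ℕ) : Type := {p : Fin n × Fin n // p.1 ≠ p.2}

/-- The free monoid on the operators; its elements are the compositions of operators, and the
degree of a composition is its `FreeMonoid.length`. -/
abbrev Comp (n : ℕ) : Type := FreeMonoid (Op n)

/-- The action of a single operator on `S_n[q]`, with values in `S_n[q] ∪ {0}` (`none` is `0`). -/
def opAct {n : ℕ} (k : ℕ) (o : Op n) (x : QPerm n) : Option (QPerm n) :=
  let a := o.1.1
  let b := o.1.2
  let i := x.2⁻¹ a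
  let j := x.2⁻¹ b
  if a < b ∧ QCover k x (x.1, Equiv.swap a b * x.2) then
    some (x.1, Equiv.swap a b * x.2)
  else if b < a ∧ i < j ∧ QCover k x (x.1 + qExp i j, Equiv.swap a b * x.2) then
    some (x.1 + qExp i j, Equiv.swap a b * x.2)
  else none

/-- The left action of a composition on `S_n[q] ∪ {0}`: the rightmost operator acts first. -/
def compAct {n : ℕ} (k : ℕ) (v : Comp n) (x : Option (QPerm n)) : Option (QPerm n) :=
  v.toList.foldr (fun o y => y.bind (opAct k o)) x

/-- The action of the free monoid with a zero element adjoined; `0` sends everything to `0`. -/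
def act {n : ℕ} (k : ℕ) (v : WithZero (Comp n)) (x : Option (QPerm n)) : Option (QPerm n) :=
  WithZero.recZeroCoe none (fun w => compAct k w x) v

/-- `u ≡ v`: equal action on `S_n[q]` for every `k ∈ {1, …, n - 1}`. -/
def Equivalent {n : ℕ} (u v : WithZero (Comp n)) : Prop :=
  ∀ k : ℕ, 1 ≤ k → k < n → ∀ x : QPerm n, act k u (some x) = act k v (some x)

/-- `v` is `0` or a composition of degree less than `d`. -/
def DegreeLT {n : ℕ} (d : ℕ) (v : WithZero (Comp n)) : Prop :=
  ∀ w : Comp n, v = (w : WithZero (Comp n)) → w.length < d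

/-- The equivalences that involve only compositions of fewer than `d` operators, and `0`. -/
def LowerEquivalence {n : ℕ} (d : ℕ) (u v : WithZero (Comp n)) : Prop :=
  Equivalent u v ∧ DegreeLT d u ∧ DegreeLT d v

/-- `u ≡ v` is a consequence of equivalences of degree less than `d`: it lies in the congruence on
the monoid with zero that they generate. -/
def IsConsequence {n : ℕ} (d : ℕ) (u v : WithZero (Comp n)) : Prop :=
  conGen (LowerEquivalence d) u v

/-- `v ≡ 0` is a minimal zero equivalence of degree `d`. -/
def IsMinimalZero {n : ℕ} (d : ℕ) (v : Comp n) : Prop :=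
  v.length = d ∧ Equivalent (v : WithZero (Comp n)) 0 ∧ ¬ IsConsequence d (v : WithZero (Comp n)) 0

/-- `u ≡ v` is a minimal non-zero equivalence of degree `d`. -/
def IsMinimalNonzero {n : ℕ} (d : ℕ) (u v : Comp n) : Prop :=
  u.length = d ∧ v.length = d ∧
    Equivalent (u : WithZero (Comp n)) v ∧ ¬ Equivalent (u : WithZero (Comp n)) 0 ∧
    ¬ IsConsequence d (u : WithZero (Comp n)) v

/-- The set of indices that occur in a composition. -/
def supp {n : ℕ} (v : Comp n) : Finset (Fin n) :=
  v.toList.toFinset.biUnion fun o => {o.1.1, o.1.2}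

/-- `v_{ab} ↦ v_{σ(a)σ(b)}`. -/
def relabel {n : ℕ} (σ : Equiv.Perm (Fin n)) (o : Op n) : Op n :=
  ⟨(σ o.1.1, σ o.1.2), σ.injective.ne o.2⟩

/-- `v_{ab} ↦ v_{σ(b)σ(a)}`. -/
def relabelSwap {n : ℕ} (σ : Equiv.Perm (Fin n)) (o : Op n) : Op n :=
  ⟨(σ o.1.2, σ o.1.1), σ.injective.ne o.2.symm⟩

/-- A permutation of the indices that restricts to the order-preserving bijection from `S` onto the
first `|S|` indices (and lists the complement of `S` after them). -/
def flattenPerm {n : ℕ} (S : Finset (Fin n)) : Equiv.Perm (Fin n) :=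
  (finSumEquivOfFinset (s := S) rfl rfl).symm.trans
    (finSumFinEquiv.trans (finCongr (S.card_add_card_compl.trans (Fintype.card_fin n))))

/-- On `S = {t_1 < ⋯ < t_m}` this is `t_i ↦ t_{i+1}`, `t_m ↦ t_1`; it fixes the complement. -/
def shiftPerm {n : ℕ} (S : Finset (Fin n)) : Equiv.Perm (Fin n) :=
  (finRotate S.card).extendDomain (S.orderIsoOfFin rfl).toEquiv

/-- On `S = {t_1 < ⋯ < t_m}` this is `t_i ↦ t_{m-i+1}`; it fixes the complement. -/
def flipPerm {n : ℕ} (S : Finset (Fin n)) : Equiv.Perm (Fin n) :=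
  (Fin.revPerm (n := S.card)).extendDomain (S.orderIsoOfFin rfl).toEquiv

/-- Flattening. -/
def flatten {n : ℕ} (v : Comp n) : Comp n := FreeMonoid.map (relabel (flattenPerm (supp v))) v

/-- The cyclic shift of the indices along the support. -/
def cyclicShift {n : ℕ} (v : Comp n) : Comp n := FreeMonoid.map (relabel (shiftPerm (supp v))) v

/-- The horizontal flip. -/
def horizontalFlip {n : ℕ} (v : Comp n) : Comp n :=
  FreeMonoid.map (relabelSwap (flipPerm (supp v))) v

/-- The vertical flip: the operators in reverse order. -/
def verticalFlip {n : ℕ} (v : Comp n) : Comp n := FreeMonoid.reverse v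

/-- The four equivalence-preserving transformations. -/
inductive IsTransformation {n : ℕ} : (Comp n → Comp n) → Prop
  | flatten : IsTransformation flatten
  | cyclicShift : IsTransformation cyclicShift
  | horizontalFlip : IsTransformation horizontalFlip
  | verticalFlip : IsTransformation verticalFlip

/-- `v` and `w` are connected by finitely many transformations and inverses of such. -/
def Related {n : ℕ} : Comp n → Comp n → Prop :=
  Relation.EqvGen fun v w => ∃ T, IsTransformation T ∧ w = T v

/-- The pairs `p` and `q` are connected by finitely many transformations and inverses of such, each
applied to both members of a pair of compositions with the same support. -/
def PairRelated {n : ℕ} : Comp n × Comp n → Comp n × Comp n → Prop :=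
  Relation.EqvGen fun p q =>
    supp p.1 = supp p.2 ∧ ∃ T, IsTransformation T ∧ q = (T p.1, T p.2)

/-- The composition `v_{a_i a_j}` of degree one, for a strictly increasing family `a` that is
indexed from zero. -/
def v {m n : ℕ} (a : Fin m ↪o Fin n) (i j : Fin m) (h : i ≠ j := by decide) : Comp n :=
  FreeMonoid.of ⟨(a i, a j), a.injective.ne h⟩

/-- `v_{a₃a₅} v_{a₂a₃} v_{a₁a₂} v_{a₄a₁}` for `a₁ < a₂ < a₃ < a₄ < a₅`. -/
def zeroWord {n : ℕ} (a : Fin 5 ↪o Fin n) : Comp n :=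
  v a 2 4 * v a 1 2 * v a 0 1 * v a 3 0

/-- `v_{a₃a₁} v_{a₂a₃} v_{a₁a₂} v_{a₄a₁}` for `a₁ < a₂ < a₃ < a₄`. -/
def leftWord {n : ℕ} (a : Fin 4 ↪o Fin n) : Comp n :=
  v a 2 0 * v a 1 2 * v a 0 1 * v a 3 0

/-- `v_{a₄a₁} v_{a₃a₄} v_{a₂a₃} v_{a₄a₂}` for `a₁ < a₂ < a₃ < a₄`. -/
def rightWord {n : ℕ} (a : Fin 4 ↪o Fin n) : Comp n :=
  v a 3 0 * v a 2 3 * v a 1 2 * v a 3 1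

end QuantumBruhat

/-!
The operator `v_{ab}` does not annihilate `q^α w` if and only if `a` stands at one of the positions
`1, …, k`, `b` stands further right than that, and no value met on the way up from `a` to `b`, read
cyclically, stands between them. Hence two compositions are equivalent if and only if they survive
on the same arrangements of the values and multiply by the same permutation and the same power of
`q`, a condition that is invariant under order-preserving relabelling, cyclic shifts of the indices
and reversal of the composition.

A composition of degree four involves at most eight indices, so up to relabelling, cyclic shifts and
the relations of degree two and three only finitely many of them remain. An enumeration shows that
they vanish or agree only in the exceptional cases. These are minimal because either factor of
degree three of an exceptional composition acts on some arrangement as no other composition of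
degree three in the same indices does, so that no equivalence of lower degree applies to it.
-/

namespace QuantumBruhat
open Equiv

section Words

variable {α : Type*} [LinearOrder α]

/-- A composition of operators, listed in the order in which they act; `(a, b)` stands for
`v_{ab}`. -/
abbrev Word (α : Type*) : Type _ := List (α × α)

/-- `c` is met strictly between `a` and `b` on the way up from `a` to `b`, read cyclically. -/
def Cyc (a c b : α) : Prop := (a < c ∧ c < b) ∨ (c < b ∧ b < a) ∨ (b < a ∧ a < c)

instance (a c b : α) : Decidable (Cyc a c b) := inferInstanceAs (Decidable (_ ∨ _))

/-- The permutation of the values by which a word acts from the left. -/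
def permOf : Word α → Perm α
  | [] => 1
  | p :: T => permOf T * swap p.1 p.2

/-- If `φ c` is the weight of the position at which the value `c` stands, this is the sum of
`φ(j) - φ(i)` over the operators `v_{ab}`, `a > b`, of the word, where `i` and `j` are the positions
of `a` and `b` when the operator acts. It encodes the power of `q` gained by the word. -/
def wsum (φ : α → ℤ) : Word α → ℤ
  | [] => 0
  | p :: T => (if p.2 < p.1 then φ p.2 - φ p.1 else 0) + wsum (φ ∘ swap p.1 p.2) T

/-- The operator `v_{ab}` does not annihilate a permutation in which the value `c` stands at place
`F c`; the places of the positions `1, …, k` are negative. -/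
def CanApply (F : α → ℤ) (p : α × α) : Prop :=
  F p.1 < 0 ∧ 0 ≤ F p.2 ∧ ∀ c, Cyc p.1 c p.2 → F c < F p.1 ∨ F p.2 < F c

/-- No operator of the word annihilates a permutation with places `F`. -/
def Admissible : (α → ℤ) → Word α → Prop
  | _, [] => True
  | F, p :: T => CanApply F p ∧ Admissible (F ∘ swap p.1 p.2) T

/-- The words multiply by the same permutation and the same power of `q`. -/
def SameEffect (S T : Word α) : Prop :=
  permOf S = permOf T ∧ ∀ φ : α → ℤ, wsum φ S = wsum φ T

/-- The combinatorial form of the equivalence of compositions. -/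
def WordEquiv (S T : Word α) : Prop :=
  (∀ F : α → ℤ, Admissible F S ↔ Admissible F T) ∧ SameEffect S T

/-- The combinatorial form of the equivalence to zero. -/
def Vanishes (T : Word α) : Prop := ∀ F : α → ℤ, ¬ Admissible F T

lemma permOf_append (S T : Word α) : permOf (S ++ T) = permOf T * permOf S := by
  induction S with
  | nil => simp [permOf]
  | cons p S ih => simp [permOf, ih, mul_assoc]

lemma wsum_append (φ : α → ℤ) (S T : Word α) :
    wsum φ (S ++ T) = wsum φ S + wsum (φ ∘ (permOf S).symm) T := by
  induction S generalizing φ with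
  | nil => simp [permOf, wsum, Perm.one_def]
  | cons p S ih => simp [permOf, wsum, ih, Perm.mul_def, Function.comp_assoc, add_assoc]

lemma admissible_append (F : α → ℤ) (S T : Word α) :
    Admissible F (S ++ T) ↔ Admissible F S ∧ Admissible (F ∘ (permOf S).symm) T := by
  induction S generalizing F with
  | nil => simp [permOf, Admissible, Perm.one_def]
  | cons p S ih => simp [permOf, Admissible, ih, Perm.mul_def, Function.comp_assoc, and_assoc]

lemma permOf_reverse (T : Word α) : permOf T.reverse = (permOf T)⁻¹ := by
  induction T with
  | nil => simp [permOf]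
  | cons p T ih => simp [permOf, permOf_append, ih]

lemma wsum_reverse (φ : α → ℤ) (T : Word α) :
    wsum φ T.reverse = -wsum (φ ∘ permOf T) T := by
  induction T generalizing φ with
  | nil => simp [wsum]
  | cons p T ih =>
    have hswap : (φ ∘ permOf T ∘ swap p.1 p.2) ∘ swap p.1 p.2 = φ ∘ permOf T := by
      ext c; simp
    simp only [List.reverse_cons, wsum_append, ih, permOf_reverse, wsum, permOf, Perm.coe_mul,
      hswap, Perm.inv_def, symm_symm, Function.comp_apply, swap_apply_left, swap_apply_right]
    split_ifs <;> ring

lemma canApply_dual (F : α → ℤ) (p : α × α) :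
    CanApply (fun c => -1 - F (swap p.1 p.2 c)) p ↔ CanApply F p := by
  have hfix {c : α} (hc : Cyc p.1 c p.2) : swap p.1 p.2 c = c :=
    swap_apply_of_ne_of_ne (by grind [Cyc]) (by grind [Cyc])
  have hbetween :
      (∀ c, Cyc p.1 c p.2 → -1 - F (swap p.1 p.2 c) < -1 - F p.2 ∨
        -1 - F p.1 < -1 - F (swap p.1 p.2 c)) ↔
      ∀ c, Cyc p.1 c p.2 → F c < F p.1 ∨ F p.2 < F c :=
    forall₂_congr fun c hc => by rw [hfix hc]; omega
  simp only [CanApply, swap_apply_left, swap_apply_right, hbetween]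
  exact ⟨fun h => ⟨by omega, by omega, h.2.2⟩, fun h => ⟨by omega, by omega, h.2.2⟩⟩

/-- Undoing the operators of a word in the opposite order, with left and right exchanged, is
applying the reversed word. -/
lemma admissible_reverse (F : α → ℤ) (T : Word α) :
    Admissible F T.reverse ↔ Admissible (fun c => -1 - F (permOf T c)) T := by
  induction T generalizing F with
  | nil => simp [Admissible]
  | cons p T ih =>
    have hswap : (fun c => -1 - F (permOf (p :: T) c)) ∘ swap p.1 p.2 =
        fun c => -1 - F (permOf T c) := by
      ext c; simp [permOf]
    have hdual : CanApply (fun c => -1 - F (permOf (p :: T) c)) p ↔ CanApply (F ∘ permOf T) p :=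
      canApply_dual (F ∘ permOf T) p
    rw [List.reverse_cons, admissible_append, ih, Admissible, Admissible, Admissible, hswap, hdual,
      permOf_reverse, Perm.inv_def, symm_symm, and_true, and_comm]

lemma SameEffect.symm {S T : Word α} (h : SameEffect S T) : SameEffect T S :=
  ⟨h.1.symm, fun φ => (h.2 φ).symm⟩

lemma SameEffect.trans {S T U : Word α} (h : SameEffect S T) (h' : SameEffect T U) :
    SameEffect S U :=
  ⟨h.1.trans h'.1, fun φ => (h.2 φ).trans (h'.2 φ)⟩

lemma SameEffect.reverse {S T : Word α} (h : SameEffect S T) :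
    SameEffect S.reverse T.reverse :=
  ⟨by rw [permOf_reverse, permOf_reverse, h.1],
    fun φ => by rw [wsum_reverse, wsum_reverse, h.1, h.2]⟩

lemma WordEquiv.reverse {S T : Word α} (h : WordEquiv S T) : WordEquiv S.reverse T.reverse :=
  ⟨fun F => by rw [admissible_reverse, admissible_reverse, h.2.1, h.1], h.2.reverse⟩

lemma Vanishes.reverse {T : Word α} (h : Vanishes T) : Vanishes T.reverse :=
  fun F hF => h _ ((admissible_reverse F T).1 hF)

lemma WordEquiv.refl (T : Word α) : WordEquiv T T := ⟨fun _ => Iff.rfl, rfl, fun _ => rfl⟩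

lemma WordEquiv.symm {S T : Word α} (h : WordEquiv S T) : WordEquiv T S :=
  ⟨fun F => (h.1 F).symm, h.2.symm⟩

lemma WordEquiv.trans {S T U : Word α} (h : WordEquiv S T) (h' : WordEquiv T U) :
    WordEquiv S U :=
  ⟨fun F => (h.1 F).trans (h'.1 F), h.2.trans h'.2⟩

lemma WordEquiv.append {S S' T T' : Word α} (h : WordEquiv S S') (h' : WordEquiv T T') :
    WordEquiv (S ++ T) (S' ++ T') :=
  ⟨fun F => by rw [admissible_append, admissible_append, h.1, h.2.1, h'.1],
    by rw [permOf_append, permOf_append, h.2.1, h'.2.1],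
    fun φ => by rw [wsum_append, wsum_append, h.2.1, h.2.2, h'.2.2]⟩

end Words

section Covers

variable {n : ℕ}

/-- The indicator of an inversion of `w` at the positions `p` and `q`. -/
def inversion (w : Perm (Fin n)) (p q : Fin n) : ℕ := if p < q ∧ w q < w p then 1 else 0

lemma permLength_eq_sum_inversion (w : Perm (Fin n)) :
    permLength w = ∑ p, ∑ q, inversion w p q := by
  rw [permLength, Finset.card_filter, ← Finset.univ_product_univ, Finset.sum_product]
  rfl

lemma sum_sum_eq_of_pair {ι : Type*} [Fintype ι] [DecidableEq ι] {i j : ι} (hij : i ≠ j)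
    (f : ι → ι → ℕ) :
    ∑ p, ∑ q, f p q = (∑ p ∈ {i, j}ᶜ, ∑ q ∈ {i, j}ᶜ, f p q) +
      (∑ l ∈ {i, j}ᶜ, (f i l + f j l + f l i + f l j)) + (f i i + f i j + f j i + f j j) := by
  have split (g : ι → ℕ) : ∑ p, g p = g i + g j + ∑ p ∈ {i, j}ᶜ, g p := by
    rw [← Finset.sum_add_sum_compl {i, j} g, Finset.sum_pair hij]
  simp only [split, Finset.sum_add_distrib]
  ring

lemma inversion_mul_swap_add (w : Perm (Fin n)) {i j l : Fin n} (hij : i < j) (hw : w i < w j)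
    (hi : l ≠ i) (hj : l ≠ j) :
    inversion (w * swap i j) i l + inversion (w * swap i j) j l +
        inversion (w * swap i j) l i + inversion (w * swap i j) l j =
      (inversion w i l + inversion w j l + inversion w l i + inversion w l j) +
        2 * if i < l ∧ l < j ∧ w i < w l ∧ w l < w j then 1 else 0 := by
  have hwi : w l ≠ w i := w.injective.ne hi
  have hwj : w l ≠ w j := w.injective.ne hj
  simp only [inversion, Perm.mul_apply, swap_apply_left, swap_apply_right,
    swap_apply_of_ne_of_ne hi hj]
  grind (splits := 20)

lemma permLength_mul_swap (w : Perm (Fin n)) {i j : Fin n} (hij : i < j) (hw : w i < w j) :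
    permLength (w * swap i j) = permLength w + 1 +
      2 * (Finset.univ.filter fun l => i < l ∧ l < j ∧ w i < w l ∧ w l < w j).card := by
  have hcompl {l : Fin n} (hl : l ∈ ({i, j} : Finset (Fin n))ᶜ) : l ≠ i ∧ l ≠ j := by
    simpa [not_or] using hl
  have hfixed : ∀ l ∈ ({i, j} : Finset (Fin n))ᶜ, (w * swap i j) l = w l := fun l hl => by
    rw [Perm.mul_apply, swap_apply_of_ne_of_ne (hcompl hl).1 (hcompl hl).2]
  have hcard : (Finset.univ.filter fun l => i < l ∧ l < j ∧ w i < w l ∧ w l < w j).card =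
      ∑ l ∈ {i, j}ᶜ, if i < l ∧ l < j ∧ w i < w l ∧ w l < w j then 1 else 0 := by
    rw [Finset.card_filter, ← Finset.sum_add_sum_compl {i, j}, Finset.sum_pair hij.ne]
    simp
  rw [permLength_eq_sum_inversion, permLength_eq_sum_inversion, sum_sum_eq_of_pair hij.ne,
    sum_sum_eq_of_pair hij.ne, hcard,
    Finset.sum_congr rfl fun l hl => inversion_mul_swap_add w hij hw (hcompl hl).1 (hcompl hl).2,
    Finset.sum_congr rfl fun p hp => Finset.sum_congr rfl fun q hq =>
      show inversion (w * swap i j) p q = inversion w p q by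
        simp only [inversion, hfixed p hp, hfixed q hq],
    Finset.sum_add_distrib, Finset.mul_sum]
  have hpair : inversion (w * swap i j) i i + inversion (w * swap i j) i j +
      inversion (w * swap i j) j i + inversion (w * swap i j) j j =
      (inversion w i i + inversion w i j + inversion w j i + inversion w j j) + 1 := by
    simp [inversion, hij, hij.not_gt, hw, hw.not_gt]
  rw [hpair]
  ring

lemma permLength_mul_swap_add (w : Perm (Fin n)) {i j : Fin n} (hij : i < j) (hw : w j < w i) :
    permLength (w * swap i j) + 1 +
      2 * (Finset.univ.filter fun l => i < l ∧ l < j ∧ w j < w l ∧ w l < w i).card =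
    permLength w := by
  have h := permLength_mul_swap (w * swap i j) hij (by simpa using hw)
  rw [mul_assoc, swap_mul_self, mul_one] at h
  rw [h]
  congr 3
  ext l
  simp only [Finset.mem_filter, Perm.mul_apply, swap_apply_left, swap_apply_right]
  grind [swap_apply_of_ne_of_ne]

lemma sum_qExp (i j : Fin n) : ∑ l, qExp i j l = (j : ℕ) - i := by
  have hsum : ∑ l, qExp i j l =
      ∑ l ∈ Finset.range (n - 1), if (i : ℕ) ≤ l ∧ l < j then 1 else 0 := by
    rw [Finset.sum_range]
    rfl
  have hfilter : (Finset.range (n - 1)).filter (fun l => (i : ℕ) ≤ l ∧ l < j) =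
      Finset.Ico (i : ℕ) j := by
    ext l
    grind
  rw [hsum, ← Finset.card_filter, hfilter, Nat.card_Ico]

lemma qExp_ne_zero {i j : Fin n} (hij : i < j) : qExp i j ≠ 0 := fun h => by
  have hsum := sum_qExp i j
  simp only [h, Pi.zero_apply, Finset.sum_const_zero] at hsum
  omega

/-- The element `q^α w s_{ij}` or `q^α q_{ij} w s_{ij}`, the second one if `w(i) > w(j)`. -/
def moveUp (x : QPerm n) (i j : Fin n) : QPerm n :=
  (x.1 + if x.2 j < x.2 i then qExp i j else 0, x.2 * swap i j)

lemma qLength_moveUp_eq_iff (x : QPerm n) {i j : Fin n} (hij : i < j) :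
    qLength (moveUp x i j) = qLength x + 1 ↔
      ∀ l, i < l → l < j → ¬ Cyc (x.2 i) (x.2 l) (x.2 j) := by
  rcases lt_or_gt_of_ne (x.2.injective.ne hij.ne) with hw | hw
  · have hlength := permLength_mul_swap x.2 hij hw
    have hup : qLength (moveUp x i j) = qLength x + 1 ↔
        (Finset.univ.filter fun l => i < l ∧ l < j ∧ x.2 i < x.2 l ∧ x.2 l < x.2 j).card = 0 := by
      simp only [moveUp, qLength, hw.not_gt, if_false, add_zero]
      omega
    rw [hup, Finset.card_eq_zero, Finset.filter_eq_empty_iff]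
    simp only [Finset.mem_univ, true_imp_iff, Cyc]
    grind
  · have hlength := permLength_mul_swap_add x.2 hij hw
    set s := Finset.univ.filter fun l => i < l ∧ l < j ∧ x.2 j < x.2 l ∧ x.2 l < x.2 i with hs
    have hsub : s ⊆ Finset.Ioo i j := fun l hl => by
      simp only [hs, Finset.mem_filter] at hl
      exact Finset.mem_Ioo.2 ⟨hl.2.1, hl.2.2.1⟩
    have hup : qLength (moveUp x i j) = qLength x + 1 ↔ (Finset.Ioo i j).card ≤ s.card := by
      have hle := Finset.card_le_card hsub
      simp only [moveUp, qLength, hw, if_true, Pi.add_apply, Finset.sum_add_distrib, sum_qExp]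
      rw [Fin.card_Ioo] at hle ⊢
      omega
    have heq : (Finset.Ioo i j).card ≤ s.card ↔ ∀ l ∈ Finset.Ioo i j, l ∈ s :=
      ⟨fun h l hl => by rwa [Finset.eq_of_subset_of_card_le hsub h], Finset.card_le_card⟩
    have hne {l : Fin n} (hl : l ≠ i ∧ l ≠ j) : x.2 l ≠ x.2 i ∧ x.2 l ≠ x.2 j :=
      ⟨x.2.injective.ne hl.1, x.2.injective.ne hl.2⟩
    rw [hup, heq]
    simp only [hs, Finset.mem_filter, Finset.mem_univ, true_and, Finset.mem_Ioo, Cyc]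
    grind

lemma moveUp_eq_or (x : QPerm n) (i j : Fin n) :
    moveUp x i j = (x.1, x.2 * swap i j) ∨ moveUp x i j = (x.1 + qExp i j, x.2 * swap i j) := by
  rw [moveUp]
  split_ifs <;> simp

/-- The other of the two candidates for a cover has the wrong length. -/
lemma eq_moveUp_of_qLength_eq {x y : QPerm n} {i j : Fin n} (hij : i < j)
    (hy : y = (x.1, x.2 * swap i j) ∨ y = (x.1 + qExp i j, x.2 * swap i j))
    (hlength : qLength y = qLength x + 1) : y = moveUp x i j := by
  rcases lt_or_gt_of_ne (x.2.injective.ne hij.ne) with hw | hw <;> rcases hy with rfl | rfl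
  · simp [moveUp, hw.not_gt]
  · have h := permLength_mul_swap x.2 hij hw
    simp only [qLength, Pi.add_apply, Finset.sum_add_distrib, sum_qExp] at hlength
    omega
  · have h := permLength_mul_swap_add x.2 hij hw
    simp only [qLength] at hlength
    omega
  · simp [moveUp, hw]

lemma qCover_iff_moveUp {k : ℕ} {x y : QPerm n} :
    QCover k x y ↔ ∃ i j : Fin n, (i : ℕ) < k ∧ k ≤ j ∧ y = moveUp x i j ∧
      ∀ l, i < l → l < j → ¬ Cyc (x.2 i) (x.2 l) (x.2 j) := by
  refine exists₂_congr fun i j => and_congr_right fun hi => ?_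
  rw [Nat.lt_succ_iff]
  refine and_congr_right fun hj => ?_
  have hij : i < j := by omega
  rw [← qLength_moveUp_eq_iff x hij]
  constructor
  · rintro ⟨hy, hlength⟩
    obtain rfl := eq_moveUp_of_qLength_eq hij hy hlength
    exact ⟨rfl, hlength⟩
  · rintro ⟨rfl, hlength⟩
    exact ⟨moveUp_eq_or x i j, hlength⟩

/-- The places of the values, counted from the bar between the positions `k` and `k + 1`. -/
def place (k : ℕ) (w : Perm (Fin n)) (c : Fin n) : ℤ := ((w.symm c : ℕ) : ℤ) - k

lemma place_swap_mul (k : ℕ) (w : Perm (Fin n)) (a b : Fin n) :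
    place k (swap a b * w) = place k w ∘ swap a b := rfl

lemma place_injective (k : ℕ) (w : Perm (Fin n)) : Function.Injective (place k w) := by
  intro c d h
  simpa [place, Fin.val_inj] using h

lemma canApply_place_iff (k : ℕ) (w : Perm (Fin n)) (i j : Fin n) :
    CanApply (place k w) (w i, w j) ↔ (i : ℕ) < k ∧ k ≤ j ∧
      ∀ l, i < l → l < j → ¬ Cyc (w i) (w l) (w j) := by
  have hbetween : (∀ c, Cyc (w i) c (w j) → place k w c < place k w (w i) ∨
      place k w (w j) < place k w c) ↔ ∀ l, i < l → l < j → ¬ Cyc (w i) (w l) (w j) := by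
    rw [← w.forall_congr_right]
    refine forall_congr' fun l => ?_
    have hi : Cyc (w i) (w l) (w j) → l ≠ i := by rintro h rfl; grind [Cyc]
    have hj : Cyc (w i) (w l) (w j) → l ≠ j := by rintro h rfl; grind [Cyc]
    simp only [place, symm_apply_apply]
    grind
  rw [CanApply, hbetween]
  simp only [place, symm_apply_apply]
  refine and_congr ?_ (and_congr ?_ Iff.rfl) <;> omega

lemma eq_or_eq_of_swap_eq_swap {α : Type*} [DecidableEq α] {a b c d : α} (hab : a ≠ b)
    (h : swap a b = swap c d) : (a = c ∧ b = d) ∨ (a = d ∧ b = c) := by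
  have ha := swap_apply_left a b
  have hb := swap_apply_right a b
  rw [h] at ha hb
  grind

lemma qCover_moveUp_iff {k : ℕ} {x : QPerm n} {i j : Fin n} (hne : i ≠ j)
    (hij : x.2 j < x.2 i → i < j) :
    QCover k x (moveUp x i j) ↔ CanApply (place k x.2) (x.2 i, x.2 j) := by
  rw [canApply_place_iff, qCover_iff_moveUp]
  constructor
  · rintro ⟨i', j', hi, hj, heq, hbetween⟩
    rcases eq_or_eq_of_swap_eq_swap hne (mul_left_cancel (congrArg Prod.snd heq)) with
      ⟨rfl, rfl⟩ | ⟨rfl, rfl⟩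
    · exact ⟨hi, hj, hbetween⟩
    · have hji : j < i := by omega
      have hw : x.2 i < x.2 j := (x.2.injective.ne hne).lt_or_gt.resolve_right
        fun h => (hij h).not_gt hji
      have hexp : x.1 + 0 = x.1 + qExp j i := by
        simpa [moveUp, hw, hw.not_gt] using congrArg Prod.fst heq
      exact absurd (add_left_cancel hexp).symm (qExp_ne_zero hji)
  · rintro ⟨hi, hj, hbetween⟩
    exact ⟨i, j, hi, hj, rfl, hbetween⟩

lemma opAct_eq_some_iff {k : ℕ} {o : Op n} {x y : QPerm n} :
    opAct k o x = some y ↔ CanApply (place k x.2) o.1 ∧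
      y = moveUp x (x.2.symm o.1.1) (x.2.symm o.1.2) := by
  obtain ⟨⟨a, b⟩, hab⟩ := o
  obtain ⟨i, rfl⟩ := x.2.surjective a
  obtain ⟨j, rfl⟩ := x.2.surjective b
  have hne : i ≠ j := fun h => hab (h ▸ rfl)
  simp only [opAct, Perm.inv_def, symm_apply_apply, ← mul_swap_eq_swap_mul]
  rcases lt_or_gt_of_ne (x.2.injective.ne hne) with hw | hw
  · have hmove : moveUp x i j = (x.1, x.2 * swap i j) := by simp [moveUp, hw.not_gt]
    have hcover := qCover_moveUp_iff (k := k) hne fun h => absurd h hw.not_gt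
    rw [hmove] at hcover ⊢
    grind
  · have hmove : moveUp x i j = (x.1 + qExp i j, x.2 * swap i j) := by simp [moveUp, hw]
    have hcover (hij : i < j) := qCover_moveUp_iff (k := k) (x := x) hne fun _ => hij
    have hlt : CanApply (place k x.2) (x.2 i, x.2 j) → i < j := fun h => by
      have := (canApply_place_iff k x.2 i j).1 h
      omega
    rw [hmove] at hcover ⊢
    grind

end Covers

section Action

variable {n : ℕ}

/-- The composition of the operators of a word, or `0` if the word contains a pair `(a, a)`. -/
def word : Word (Fin n) → WithZero (Comp n)
  | [] => 1
  | p :: T => word T *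
      if h : p.1 ≠ p.2 then ((FreeMonoid.of ⟨p, h⟩ : Comp n) : WithZero (Comp n)) else 0

/-- The operators of a composition, the one that acts first at the head. -/
def opList (v : Comp n) : Word (Fin n) := (v.toList.map Subtype.val).reverse

lemma word_append (S T : Word (Fin n)) : word (S ++ T) = word T * word S := by
  induction S with
  | nil => simp [word]
  | cons p S ih => simp only [List.cons_append, word, ih, mul_assoc]

lemma opList_mul (u v : Comp n) : opList (u * v) = opList v ++ opList u := by
  simp [opList, FreeMonoid.toList_mul]

lemma opList_of (o : Op n) : opList (FreeMonoid.of o) = [o.1] := rfl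

lemma word_opList (v : Comp n) : word (opList v) = (v : WithZero (Comp n)) := by
  induction v using FreeMonoid.recOn with
  | one => rfl
  | of_mul o v ih => simp [opList_mul, opList_of, word_append, ih, word, o.2]

lemma opList_eq_of_word_eq {T : Word (Fin n)} {v : Comp n} (h : word T = v) : opList v = T := by
  induction T generalizing v with
  | nil => rw [← WithZero.coe_inj.1 (WithZero.coe_one.symm.trans h)]; rfl
  | cons p T ih =>
    obtain ⟨u, hu⟩ := WithZero.ne_zero_iff_exists.1 (left_ne_zero_of_mul (h ▸ WithZero.coe_ne_zero))
    rw [word, ← hu] at h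
    split_ifs at h with hp
    · rw [← WithZero.coe_mul, WithZero.coe_inj] at h
      rw [← h, opList_mul, opList_of, ih hu.symm, List.singleton_append]
    · exact absurd (h.symm.trans (mul_zero _)) WithZero.coe_ne_zero

lemma length_opList (v : Comp n) : (opList v).length = v.length := by
  simp [opList, FreeMonoid.length]

lemma opList_injective : Function.Injective (opList (n := n)) := fun u v h =>
  WithZero.coe_inj.1 (by rw [← word_opList, h, word_opList])

lemma act_zero (k : ℕ) (x : Option (QPerm n)) : act k 0 x = none := rfl

lemma act_one (k : ℕ) (x : Option (QPerm n)) : act k 1 x = x := rfl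

lemma act_coe (k : ℕ) (v : Comp n) (x : Option (QPerm n)) :
    act k (v : WithZero (Comp n)) x = compAct k v x := rfl

lemma act_none (k : ℕ) (u : WithZero (Comp n)) : act k u none = none := by
  induction u with
  | zero => rfl
  | coe v =>
    rw [act_coe, compAct]
    induction v.toList with
    | nil => rfl
    | cons o l ih => rw [List.foldr_cons, ih, Option.bind_none]

lemma act_mul (k : ℕ) (u v : WithZero (Comp n)) (x : Option (QPerm n)) :
    act k (u * v) x = act k u (act k v x) := by
  induction u with
  | zero => rw [zero_mul, act_zero, act_zero]
  | coe u =>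
    induction v with
    | zero => rw [mul_zero, act_zero, act_none]
    | coe v =>
      simp only [← WithZero.coe_mul, act_coe, compAct, FreeMonoid.toList_mul, List.foldr_append]

/-- The weight of a position for which `wsum` becomes the exponent of `q_{l+1}`. -/
def threshold (l : Fin (n - 1)) (w : Perm (Fin n)) (c : Fin n) : ℤ :=
  if (l : ℕ) < w.symm c then 1 else 0

lemma threshold_swap_mul (l : Fin (n - 1)) (w : Perm (Fin n)) (a b : Fin n) :
    threshold l (swap a b * w) = threshold l w ∘ swap a b := rfl

lemma act_word_cons (k : ℕ) (p : Fin n × Fin n) (T : Word (Fin n)) (x y : QPerm n) :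
    act k (word (p :: T)) (some x) = some y ↔ CanApply (place k x.2) p ∧
      act k (word T) (some (moveUp x (x.2.symm p.1) (x.2.symm p.2))) = some y := by
  rw [word, act_mul]
  split_ifs with hp
  · rw [act_coe]
    have hop (z : QPerm n) := opAct_eq_some_iff (k := k) (o := ⟨p, hp⟩) (x := x) (y := z)
    simp only [compAct, FreeMonoid.toList_of, List.foldr_cons, List.foldr_nil, Option.bind_some]
    cases h : opAct k ⟨p, hp⟩ x with
    | none => simp_all [act_none]
    | some z =>
      obtain ⟨hcan, rfl⟩ := (hop z).1 h
      simp [hcan]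
  · rw [act_zero, act_none]
    have : ¬ CanApply (place k x.2) p := fun h => by
      rw [not_not] at hp
      have := h.1
      rw [hp] at this
      exact this.not_ge h.2.1
    simp [this]

lemma moveUp_fst_eq {k : ℕ} {x : QPerm n} {p : Fin n × Fin n} (h : CanApply (place k x.2) p)
    (l : Fin (n - 1)) :
    ((moveUp x (x.2.symm p.1) (x.2.symm p.2)).1 l : ℤ) =
      x.1 l + if p.2 < p.1 then threshold l x.2 p.2 - threshold l x.2 p.1 else 0 := by
  have hleft := h.1
  have hright := h.2.1
  simp only [place] at hleft hright
  simp only [moveUp, apply_symm_apply, threshold]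
  split_ifs <;> simp [qExp] <;> omega

lemma moveUp_snd_eq (x : QPerm n) (a b : Fin n) :
    (moveUp x (x.2.symm a) (x.2.symm b)).2 = swap a b * x.2 := by
  rw [moveUp, mul_swap_eq_swap_mul, apply_symm_apply, apply_symm_apply]

lemma act_word_eq_some_iff {k : ℕ} {T : Word (Fin n)} {x y : QPerm n} :
    act k (word T) (some x) = some y ↔ Admissible (place k x.2) T ∧ y.2 = permOf T * x.2 ∧
      ∀ l, (y.1 l : ℤ) = x.1 l + wsum (threshold l x.2) T := by
  induction T generalizing x with
  | nil =>
    simp only [word, act_one, Option.some.injEq, Admissible, permOf, one_mul, wsum, add_zero,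
      Nat.cast_inj, true_and, Prod.ext_iff, funext_iff]
    grind
  | cons p T ih =>
    rw [act_word_cons, ih, Admissible, and_assoc]
    refine and_congr_right fun hcan => ?_
    simp only [moveUp_snd_eq, place_swap_mul, threshold_swap_mul, moveUp_fst_eq hcan, permOf, wsum,
      mul_assoc, add_assoc]

lemma exists_act_word_eq_some_iff {k : ℕ} {T : Word (Fin n)} {x : QPerm n} :
    (∃ y, act k (word T) (some x) = some y) ↔ Admissible (place k x.2) T := by
  induction T generalizing x with
  | nil => simp [word, act_one, Admissible]
  | cons p T ih =>
    simp only [act_word_cons, exists_and_left, ih, Admissible, moveUp_snd_eq, place_swap_mul]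

lemma act_word_eq_none_iff {k : ℕ} {T : Word (Fin n)} {x : QPerm n} :
    act k (word T) (some x) = none ↔ ¬ Admissible (place k x.2) T := by
  rw [← exists_act_word_eq_some_iff, Option.eq_none_iff_forall_ne_some, not_exists]

lemma qLength_of_act_word {k : ℕ} {T : Word (Fin n)} {x y : QPerm n}
    (h : act k (word T) (some x) = some y) : qLength y = qLength x + T.length := by
  induction T generalizing x with
  | nil =>
    obtain rfl := Option.some.inj h
    rfl
  | cons p T ih =>
    rw [act_word_cons] at h
    obtain ⟨hi, hj, hbetween⟩ :=
      (canApply_place_iff k x.2 (x.2.symm p.1) (x.2.symm p.2)).1 (by simpa using h.1)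
    rw [ih h.2, (qLength_moveUp_eq_iff x (by omega)).2 hbetween, List.length_cons]
    ring

end Action

section Criterion

variable {n : ℕ}

lemma wsum_add {α : Type*} [LinearOrder α] (T : Word α) (φ ψ : α → ℤ) :
    wsum (φ + ψ) T = wsum φ T + wsum ψ T := by
  induction T generalizing φ ψ with
  | nil => rfl
  | cons p T ih =>
    have hcomp : (φ + ψ) ∘ swap p.1 p.2 = φ ∘ swap p.1 p.2 + ψ ∘ swap p.1 p.2 := rfl
    rw [wsum, wsum, wsum, hcomp, ih, Pi.add_apply, Pi.add_apply]
    split_ifs <;> ring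

lemma wsum_const {α : Type*} [LinearOrder α] (T : Word α) (z : ℤ) : wsum (fun _ => z) T = 0 := by
  induction T with
  | nil => rfl
  | cons p T ih =>
    rw [wsum, sub_self, ite_self, zero_add]
    exact ih

/-- Summation by parts. -/
lemma eq_const_add_sum_threshold (w : Perm (Fin n)) (ψ : ℕ → ℤ) :
    (fun c => ψ (w.symm c)) =
      (fun _ => ψ 0) + ∑ l : Fin (n - 1), (ψ (l + 1) - ψ l) • threshold l w := by
  funext c
  have hle : (w.symm c : ℕ) ≤ n - 1 := by omega
  simp only [Pi.add_apply, Finset.sum_apply, Pi.smul_apply, threshold, smul_eq_mul, mul_ite,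
    mul_one, mul_zero]
  rw [← sub_eq_iff_eq_add', ← Finset.sum_range_sub,
    Fin.sum_univ_eq_sum_range (fun l => if l < (w.symm c : ℕ) then ψ (l + 1) - ψ l else 0),
    ← Finset.sum_filter]
  congr 1
  ext l
  simp only [Finset.mem_range, Finset.mem_filter]
  omega

lemma wsum_eq_of_threshold {S T : Word (Fin n)} (w : Perm (Fin n))
    (h : ∀ l, wsum (threshold l w) S = wsum (threshold l w) T) (φ : Fin n → ℤ) :
    wsum φ S = wsum φ T := by
  let weight (U : Word (Fin n)) : (Fin n → ℤ) →+ ℤ := AddMonoidHom.mk' (wsum · U) (wsum_add U)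
  have hsum (U : Word (Fin n)) (ψ : ℕ → ℤ) : wsum (fun c => ψ (w.symm c)) U =
      ∑ l : Fin (n - 1), (ψ (l + 1) - ψ l) • wsum (threshold l w) U := by
    rw [eq_const_add_sum_threshold, wsum_add, wsum_const, zero_add]
    exact (map_sum (weight U) _ _).trans (Finset.sum_congr rfl fun l _ => map_zsmul (weight U) _ _)
  obtain ⟨ψ, rfl⟩ : ∃ ψ : ℕ → ℤ, φ = fun c => ψ (w.symm c) :=
    ⟨fun i => if hi : i < n then φ (w ⟨i, hi⟩) else 0, by simp⟩
  rw [hsum S, hsum T]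
  simp only [h]

lemma admissible_congr {α : Type*} [LinearOrder α] {F G : α → ℤ} (h0 : ∀ c, F c < 0 ↔ G c < 0)
    (hlt : ∀ c d, F c < F d ↔ G c < G d) (T : Word α) : Admissible F T ↔ Admissible G T := by
  induction T generalizing F G with
  | nil => rfl
  | cons p T ih =>
    have hcan : CanApply F p ↔ CanApply G p := by simp only [CanApply, h0, hlt, ← not_lt]
    exact and_congr hcan (ih (fun c => h0 _) fun c d => hlt _ _)

lemma exists_place {F : Fin n → ℤ} (hF : Function.Injective F) : ∃ k, ∃ w : Perm (Fin n),
    (∀ c, place k w c < 0 ↔ F c < 0) ∧ ∀ c d, place k w c < place k w d ↔ F c < F d := by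
  set w : Perm (Fin n) := Tuple.sort F
  have hmono : StrictMono (F ∘ w) :=
    (Tuple.monotone_sort F).strictMono_of_injective (hF.comp w.injective)
  refine ⟨(Finset.univ.filter fun i => (F ∘ w) i < 0).card, w, fun c => ?_, fun c d => ?_⟩
  · have := Tuple.lt_card_lt_iff_apply_lt_of_monotone (j := w.symm c) (a := 0) hmono.monotone
    rw [Function.comp_apply, apply_symm_apply] at this
    rw [← this, place, sub_neg, Nat.cast_lt]
  · have := hmono.lt_iff_lt (a := w.symm c) (b := w.symm d)
    rw [Function.comp_apply, Function.comp_apply, apply_symm_apply, apply_symm_apply] at this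
    rw [this, place, place, sub_lt_sub_iff_right, Nat.cast_lt, Fin.lt_def]

lemma exists_act_of_admissible {T : Word (Fin n)} (hT : T ≠ []) {F : Fin n → ℤ}
    (hF : Function.Injective F) (h : Admissible F T) : ∃ k w, 1 ≤ k ∧ k < n ∧
      (∀ U, Admissible (place k w) U ↔ Admissible F U) ∧
      ∃ y, act k (word T) (some (0, w)) = some y := by
  obtain ⟨k, w, h0, hlt⟩ := exists_place hF
  have hcongr (U) := admissible_congr h0 hlt U
  obtain ⟨p, T, rfl⟩ := List.exists_cons_of_ne_nil hT
  have hleft := (h0 _).2 h.1.1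
  have hright := mt (h0 _).1 h.1.2.1.not_gt
  simp only [place] at hleft hright
  exact ⟨k, w, by omega, by omega, hcongr, exists_act_word_eq_some_iff.2 ((hcongr _).2 h)⟩

lemma Equivalent.refl (u : WithZero (Comp n)) : Equivalent u u := fun _ _ _ _ => rfl

lemma Equivalent.symm {u v : WithZero (Comp n)} (h : Equivalent u v) : Equivalent v u :=
  fun k hk hk' x => (h k hk hk' x).symm

lemma Equivalent.trans {u v w : WithZero (Comp n)} (h : Equivalent u v) (h' : Equivalent v w) :
    Equivalent u w :=
  fun k hk hk' x => (h k hk hk' x).trans (h' k hk hk' x)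

lemma WordEquiv.equivalent {S T : Word (Fin n)} (h : WordEquiv S T) :
    Equivalent (word S) (word T) := fun k _ _ x => by
  cases hS : act k (word S) (some x) with
  | none => rw [act_word_eq_none_iff, h.1] at hS; exact (act_word_eq_none_iff.2 hS).symm
  | some y =>
    obtain ⟨hadm, hperm, hpow⟩ := act_word_eq_some_iff.1 hS
    refine (act_word_eq_some_iff.2 ⟨(h.1 _).1 hadm, h.2.1 ▸ hperm, fun l => ?_⟩).symm
    rw [hpow, h.2.2]

lemma Vanishes.equivalent {T : Word (Fin n)} (h : Vanishes T) : Equivalent (word T) 0 :=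
  fun _ _ _ _ => act_word_eq_none_iff.2 (h _)

lemma admissible_and_sameEffect_of_equivalent {S T : Word (Fin n)}
    (h : Equivalent (word S) (word T)) (hS : S ≠ []) {F : Fin n → ℤ} (hF : Function.Injective F)
    (hadm : Admissible F S) : Admissible F T ∧ SameEffect S T := by
  obtain ⟨k, w, hk, hkn, hcongr, y, hy⟩ := exists_act_of_admissible hS hF hadm
  obtain ⟨-, hperm, hpow⟩ := act_word_eq_some_iff.1 hy
  rw [h k hk hkn] at hy
  obtain ⟨hadm', hperm', hpow'⟩ := act_word_eq_some_iff.1 hy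
  refine ⟨(hcongr T).1 hadm', mul_right_cancel (hperm.symm.trans hperm'),
    wsum_eq_of_threshold w fun l => ?_⟩
  have hl := hpow l
  rw [hpow' l] at hl
  exact (add_left_cancel hl).symm

lemma length_eq_of_equivalent {S T : Word (Fin n)} (h : Equivalent (word S) (word T))
    (hS : S ≠ []) {F : Fin n → ℤ} (hF : Function.Injective F) (hadm : Admissible F S) :
    S.length = T.length := by
  obtain ⟨k, w, hk, hkn, -, y, hy⟩ := exists_act_of_admissible hS hF hadm
  have hlength := qLength_of_act_word hy
  rw [h k hk hkn] at hy
  have := qLength_of_act_word hy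
  omega

lemma not_equivalent_zero {T : Word (Fin n)} (hT : T ≠ []) {F : Fin n → ℤ}
    (hF : Function.Injective F) (h : Admissible F T) : ¬ Equivalent (word T) 0 := fun h0 => by
  obtain ⟨k, w, hk, hkn, -, y, hy⟩ := exists_act_of_admissible hT hF h
  rw [h0 k hk hkn, act_zero] at hy
  cases hy

lemma exists_admissible_of_not_equivalent_zero {T : Word (Fin n)} (h : ¬ Equivalent (word T) 0) :
    ∃ F : Fin n → ℤ, Function.Injective F ∧ Admissible F T := by
  by_contra! hnone
  exact h fun k _ _ x => act_word_eq_none_iff.2 (hnone _ (place_injective k x.2))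

end Criterion

section Relations

variable {α : Type*} [LinearOrder α]

/-- The two operators have no index in common. -/
def DisjointOps (p q : α × α) : Prop := q.1 ≠ p.1 ∧ q.1 ≠ p.2 ∧ q.2 ≠ p.1 ∧ q.2 ≠ p.2

instance (p q : α × α) : Decidable (DisjointOps p q) := inferInstanceAs (Decidable (_ ∧ _))

/-- Equivalences of degree two and three by which longer words are reduced: commutations, and braid
relations in which `a, b, c` are in cyclic order. -/
inductive BraidMove : Word α → Word α → Prop
  | commute {p q : α × α} (h : DisjointOps p q) : BraidMove [p, q] [q, p]
  | braid {a b c d : α} (h : Cyc a b c) (hd : d = c ∨ Cyc c d a) :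
      BraidMove [(a, b), (b, c), (d, b)] [(a, c), (d, a), (a, b)]
  | braid_reverse {a b c d : α} (h : Cyc a b c) (hd : d = c ∨ Cyc c d a) :
      BraidMove [(d, b), (b, c), (a, b)] [(a, b), (d, a), (a, c)]

/-- The congruence on words generated by `BraidMove`. -/
inductive BraidEquiv : Word α → Word α → Prop
  | move {S T : Word α} (h : BraidMove S T) : BraidEquiv S T
  | append {S S' T T' : Word α} (h : BraidEquiv S S') (h' : BraidEquiv T T') :
      BraidEquiv (S ++ T) (S' ++ T')
  | refl (T : Word α) : BraidEquiv T T
  | symm {S T : Word α} (h : BraidEquiv S T) : BraidEquiv T S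
  | trans {S T U : Word α} (h : BraidEquiv S T) (h' : BraidEquiv T U) : BraidEquiv S U

/-- Two operators one of which annihilates everything that the other does not; `p` acts first. -/
def ZeroPair (p q : α × α) : Prop :=
  q.1 = p.1 ∨ q.2 = p.2 ∨ (q.1 = p.2 ∧ Cyc p.1 q.2 p.2) ∨ (q.2 = p.1 ∧ Cyc p.1 q.1 p.2) ∨
    (DisjointOps p q ∧ ((Cyc p.1 q.1 p.2 ∧ ¬ Cyc p.1 q.2 p.2) ∨
      (¬ Cyc p.1 q.1 p.2 ∧ Cyc p.1 q.2 p.2) ∨ (Cyc p.1 q.1 p.2 ∧ Cyc q.1 p.1 q.2)))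

instance (p q : α × α) : Decidable (ZeroPair p q) := inferInstanceAs (Decidable (_ ∨ _))

/-- Three operators whose composition `r q p` is zero though neither `q p` nor `r q` need be. -/
def ZeroTriple (p q r : α × α) : Prop :=
  (p = r ∧ ((q.1 = p.2 ∧ Cyc p.1 p.2 q.2) ∨ (q.2 = p.1 ∧ Cyc q.1 p.1 p.2))) ∨
    (q.1 = p.2 ∧ r.1 = q.2 ∧ Cyc p.1 r.2 p.2 ∧ Cyc p.2 q.2 p.1) ∨
    (q.2 = p.1 ∧ r.2 = q.1 ∧ Cyc r.1 p.2 q.1 ∧ Cyc q.1 p.1 r.1)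

instance (p q r : α × α) : Decidable (ZeroTriple p q r) := inferInstanceAs (Decidable (_ ∨ _))

lemma ZeroPair.vanishes {p q : α × α} (h : ZeroPair p q) : Vanishes [p, q] := by
  obtain ⟨a, b⟩ := p
  obtain ⟨c, d⟩ := q
  intro F hF
  simp only [Admissible, CanApply, Function.comp, swap_apply_def, and_true, ZeroPair, DisjointOps,
    Cyc] at h hF
  grind

lemma ZeroTriple.vanishes {p q r : α × α} (h : ZeroTriple p q r) : Vanishes [p, q, r] := by
  have hthird {a b d f : α} (hf : Cyc a f b) (hd : Cyc b d a) :
      Vanishes [(a, b), (b, d), (d, f)] := fun F hF => by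
    simp only [Admissible, CanApply, Function.comp, swap_apply_def, and_true, Cyc] at hf hd hF
    grind
  obtain ⟨a, b⟩ := p
  obtain ⟨c, d⟩ := q
  obtain ⟨e, f⟩ := r
  rcases h with ⟨hpr, ⟨rfl, h⟩ | ⟨rfl, h⟩⟩ | ⟨rfl, rfl, h, h'⟩ | ⟨rfl, rfl, h, h'⟩
  · obtain ⟨rfl, rfl⟩ := Prod.mk.inj hpr
    intro F hF
    simp only [Admissible, CanApply, Function.comp, swap_apply_def, and_true, Cyc] at h hF
    grind
  · obtain ⟨rfl, rfl⟩ := Prod.mk.inj hpr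
    intro F hF
    simp only [Admissible, CanApply, Function.comp, swap_apply_def, and_true, Cyc] at h hF
    grind
  · exact hthird h h'
  · exact (hthird h h').reverse

lemma DisjointOps.wordEquiv {p q : α × α} (h : DisjointOps p q) : WordEquiv [p, q] [q, p] := by
  obtain ⟨a, b⟩ := p
  obtain ⟨c, d⟩ := q
  refine ⟨fun F => ?_, ?_, fun φ => ?_⟩
  · simp only [Admissible, CanApply, Function.comp, swap_apply_def, and_true, DisjointOps,
      Cyc] at h ⊢
    grind
  · ext x
    simp only [DisjointOps, permOf, Perm.mul_apply, Perm.one_apply, swap_apply_def] at h ⊢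
    grind
  · simp only [DisjointOps, wsum, Function.comp, swap_apply_def] at h ⊢
    grind

lemma admissible_braid_iff {a b c d : α} (h : Cyc a b c) (hd : d = c ∨ Cyc c d a) (F : α → ℤ) :
    Admissible F [(a, b), (b, c), (d, b)] ↔ Admissible F [(a, c), (d, a), (a, b)] := by
  obtain ⟨hab, hac, hbc⟩ : a ≠ b ∧ a ≠ c ∧ b ≠ c := by grind [Cyc]
  rcases hd with rfl | hd
  · simp only [Admissible, CanApply, Function.comp, swap_apply_def, and_true, Cyc, if_true,
      hac, hbc, hab.symm, hac.symm, hbc.symm] at h ⊢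
    constructor <;> rintro ⟨⟨_, _, _⟩, ⟨_, _, _⟩, _, _, _⟩ <;>
      refine ⟨⟨?_, ?_, fun x hx => ?_⟩, ⟨?_, ?_, fun x hx => ?_⟩, ?_, ?_, fun x hx => ?_⟩ <;> grind
  · obtain ⟨hda, hdb, hdc⟩ : d ≠ a ∧ d ≠ b ∧ d ≠ c := by grind [Cyc]
    simp only [Admissible, CanApply, Function.comp, swap_apply_def, and_true, Cyc, if_true,
      hac, hbc, hda, hdb, hdc, hab.symm, hac.symm, hbc.symm, hda.symm, hdb.symm] at h hd ⊢
    constructor <;> rintro ⟨⟨_, _, _⟩, ⟨_, _, _⟩, _, _, _⟩ <;>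
      refine ⟨⟨?_, ?_, fun x hx => ?_⟩, ⟨?_, ?_, fun x hx => ?_⟩, ?_, ?_, fun x hx => ?_⟩ <;> grind

lemma sameEffect_braid {a b c d : α} (h : Cyc a b c) (hd : d = c ∨ Cyc c d a) :
    SameEffect [(a, b), (b, c), (d, b)] [(a, c), (d, a), (a, b)] := by
  refine ⟨?_, fun φ => ?_⟩
  · ext x
    simp only [Cyc, permOf, Perm.mul_apply, Perm.one_apply, swap_apply_def] at h hd ⊢
    grind
  · simp only [Cyc, wsum, Function.comp, swap_apply_def] at h hd ⊢
    grind

lemma BraidMove.wordEquiv {S T : Word α} (h : BraidMove S T) : WordEquiv S T := by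
  have hbraid {a b c d : α} (h : Cyc a b c) (hd : d = c ∨ Cyc c d a) :
      WordEquiv [(a, b), (b, c), (d, b)] [(a, c), (d, a), (a, b)] :=
    ⟨admissible_braid_iff h hd, sameEffect_braid h hd⟩
  cases h with
  | commute h => exact h.wordEquiv
  | braid h hd => exact hbraid h hd
  | braid_reverse h hd => exact (hbraid h hd).reverse

lemma BraidEquiv.wordEquiv {S T : Word α} (h : BraidEquiv S T) : WordEquiv S T := by
  induction h with
  | move h => exact h.wordEquiv
  | append _ _ ih ih' => exact ih.append ih'
  | refl T => exact WordEquiv.refl T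
  | symm _ ih => exact ih.symm
  | trans _ _ ih₁ ih₂ => exact ih₁.trans ih₂

/-- The compositions of the zero equivalence of degree four and their cyclic shifts; `a, b, c, d, e`
are in cyclic order. -/
inductive IsCascade : Word α → Prop
  | mk {a b c d e : α} (h : Cyc a b c) (h' : Cyc a c d) (h'' : Cyc a d e) :
      IsCascade [(d, a), (a, b), (b, c), (c, e)]

/-- The two sides of the non-zero equivalence of degree four and their cyclic shifts; `a, b, c, d`
are in cyclic order. -/
inductive IsQuartic : Word α → Word α → Prop
  | mk {a b c d : α} (h : Cyc a b c) (h' : Cyc a c d) :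
      IsQuartic [(d, a), (a, b), (b, c), (c, a)] [(d, b), (b, c), (c, d), (d, a)]

lemma IsCascade.vanishes {T : Word α} (hT : IsCascade T) : Vanishes T := by
  obtain @⟨a, b, c, d, e, h, h', h''⟩ := hT
  obtain ⟨hab, hac, had, hbc, hbd, hcd⟩ : a ≠ b ∧ a ≠ c ∧ a ≠ d ∧ b ≠ c ∧ b ≠ d ∧ c ≠ d := by
    grind [Cyc]
  obtain ⟨hbe, hce⟩ : b ≠ e ∧ c ≠ e := by grind [Cyc]
  intro F hF
  simp only [Admissible, CanApply, Function.comp, swap_apply_def, and_true, Cyc, if_true,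
    had, hbd, hab.symm, hac.symm, hbc.symm, hbe.symm, hce.symm] at h h' h'' hF
  obtain ⟨⟨_, _, _⟩, ⟨_, _, _⟩, ⟨_, _, _⟩, _, _, _⟩ := hF
  grind

lemma IsQuartic.wordEquiv {S T : Word α} (hST : IsQuartic S T) : WordEquiv S T := by
  obtain @⟨a, b, c, d, h, h'⟩ := hST
  obtain ⟨hab, hac, had, hbc, hbd, hcd⟩ : a ≠ b ∧ a ≠ c ∧ a ≠ d ∧ b ≠ c ∧ b ≠ d ∧ c ≠ d := by
    grind [Cyc]
  refine ⟨fun F => ?_, ?_, fun φ => ?_⟩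
  · simp only [Admissible, CanApply, Function.comp, swap_apply_def, and_true, Cyc, if_true,
      hab, hac, had, hbd, hcd, hab.symm, hac.symm, hbc.symm, hbd.symm, hcd.symm] at h h' ⊢
    constructor <;> rintro ⟨⟨_, _, _⟩, ⟨_, _, _⟩, ⟨_, _, _⟩, _, _, _⟩ <;>
      refine ⟨⟨?_, ?_, fun x hx => ?_⟩, ⟨?_, ?_, fun x hx => ?_⟩, ⟨?_, ?_, fun x hx => ?_⟩, ?_, ?_,
        fun x hx => ?_⟩ <;> grind
  · ext x
    simp only [Cyc, permOf, Perm.mul_apply, Perm.one_apply, swap_apply_def] at h h' ⊢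
    grind
  · simp only [Cyc, wsum, Function.comp, swap_apply_def] at h h' ⊢
    grind

end Relations

section ZeroFactors

variable {α : Type*} [LinearOrder α]

/-- The zero equivalences of degree at most three by which longer words are recognized as zero; a
pair `(a, a)` stands for zero. -/
inductive IsZeroFactor : Word α → Prop
  | op (a : α) : IsZeroFactor [(a, a)]
  | pair {p q : α × α} (h : ZeroPair p q) : IsZeroFactor [p, q]
  | triple {p q r : α × α} (h : ZeroTriple p q r) : IsZeroFactor [p, q, r]

/-- Some consecutive operators of the word form an `IsZeroFactor`. -/
def HasZeroFactor (T : Word α) : Prop := ∃ Z, IsZeroFactor Z ∧ Z <:+: T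

lemma IsZeroFactor.vanishes {Z : Word α} (h : IsZeroFactor Z) : Vanishes Z := by
  cases h with
  | op a => exact fun F hF => hF.1.1.not_ge hF.1.2.1
  | pair h => exact h.vanishes
  | triple h => exact h.vanishes

lemma IsZeroFactor.length_lt {Z : Word α} (h : IsZeroFactor Z) : Z.length < 4 := by
  cases h <;> simp

lemma BraidMove.length_lt {S T : Word α} (h : BraidMove S T) : S.length < 4 ∧ T.length < 4 := by
  cases h <;> simp

lemma HasZeroFactor.vanishes {T : Word α} (h : HasZeroFactor T) : Vanishes T := by
  obtain ⟨Z, hZ, A, B, rfl⟩ := h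
  intro F hF
  rw [admissible_append, admissible_append] at hF
  exact hZ.vanishes _ hF.1.2

end ZeroFactors

section Consequences

variable {n : ℕ}

lemma degreeLT_word {T : Word (Fin n)} {d : ℕ} (h : T.length < d) : DegreeLT d (word T) :=
  fun w hw => by rwa [← length_opList, opList_eq_of_word_eq hw]

lemma degreeLT_zero (d : ℕ) : DegreeLT d (0 : WithZero (Comp n)) :=
  fun _ hw => absurd hw.symm WithZero.coe_ne_zero

lemma BraidEquiv.isConsequence {S T : Word (Fin n)} (h : BraidEquiv S T) :
    IsConsequence 4 (word S) (word T) := by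
  induction h with
  | move h =>
    exact ConGen.Rel.of _ _ ⟨h.wordEquiv.equivalent, degreeLT_word h.length_lt.1,
      degreeLT_word h.length_lt.2⟩
  | append _ _ ih ih' => rw [word_append, word_append]; exact (conGen _).mul ih' ih
  | refl T => exact (conGen _).refl _
  | symm _ ih => exact (conGen _).symm ih
  | trans _ _ ih ih' => exact (conGen _).trans ih ih'

lemma HasZeroFactor.isConsequence {T : Word (Fin n)} (h : HasZeroFactor T) :
    IsConsequence 4 (word T) 0 := by
  obtain ⟨Z, hZ, A, B, rfl⟩ := h
  have hzero : IsConsequence 4 (word Z) 0 := ConGen.Rel.of _ _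
    ⟨hZ.vanishes.equivalent, degreeLT_word hZ.length_lt, degreeLT_zero 4⟩
  have hprod := (conGen _).mul ((conGen _).refl (word B))
    ((conGen _).mul hzero ((conGen _).refl (word A)))
  rwa [zero_mul, mul_zero, ← word_append, ← word_append] at hprod

end Consequences

section Relabelling

variable {α β : Type*} {g : α → β}

/-- The word with its indices replaced by their images. -/
def mapWord (g : α → β) (T : Word α) : Word β := T.map (Prod.map g g)

lemma mapWord_append (S T : Word α) : mapWord g (S ++ T) = mapWord g S ++ mapWord g T :=
  List.map_append

lemma mapWord_reverse (T : Word α) : mapWord g T.reverse = (mapWord g T).reverse :=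
  List.map_reverse

lemma mapWord_mapWord {γ : Type*} (f : β → γ) (T : Word α) :
    mapWord f (mapWord g T) = mapWord (f ∘ g) T := by
  simp [mapWord, Prod.map_comp_map]

lemma exists_extension [Finite α] [Countable β] (hg : Function.Injective g) {F : α → ℤ}
    (hF : Function.Injective F) : ∃ G : β → ℤ, Function.Injective G ∧ G ∘ g = F ∧
      ∀ c ∉ Set.range g, ∀ x, G (g x) < G c := by
  obtain ⟨M, hM⟩ := (Set.finite_range F).bddAbove
  obtain ⟨index, hindex⟩ := exists_injective_nat β
  set G : β → ℤ := Function.extend g F fun c => M + 1 + index c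
  have hrange (x : α) : G (g x) = F x := hg.extend_apply _ _ x
  have hcompl {c : β} (hc : c ∉ Set.range g) : G c = M + 1 + index c :=
    Function.extend_apply' _ _ _ hc
  have hlt {c : β} (hc : c ∉ Set.range g) (x : α) : G (g x) < G c := by
    have := hM (Set.mem_range_self x)
    rw [hrange, hcompl hc]
    omega
  refine ⟨G, fun c d hcd => ?_, funext hrange, fun c => hlt⟩
  by_cases hc : c ∈ Set.range g <;> by_cases hd : d ∈ Set.range g
  · obtain ⟨⟨x, rfl⟩, ⟨y, rfl⟩⟩ := hc, hd
    rw [hrange, hrange] at hcd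
    rw [hF hcd]
  · obtain ⟨x, rfl⟩ := hc
    exact absurd hcd (hlt hd x).ne
  · obtain ⟨x, rfl⟩ := hd
    exact absurd hcd (hlt hc x).ne'
  · rw [hcompl hc, hcompl hd] at hcd
    exact hindex (by omega)

end Relabelling

section CyclicEmbeddings

variable {α β : Type*} [LinearOrder α] [LinearOrder β] {g : α → β}

/-- A relabelling that preserves the cyclic order: the indicator of a descent changes by a
coboundary `h a - h b`. -/
def IsCyclicEmbedding (g : α → β) : Prop :=
  ∃ h : α → ℤ, ∀ a b, a ≠ b →
    (if g b < g a then 1 else 0) = (if b < a then 1 else 0) + h a - h b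

lemma isCyclicEmbedding_of_strictMono (hg : StrictMono g) : IsCyclicEmbedding g :=
  ⟨0, fun a b _ => by simp [hg.lt_iff_lt]⟩

lemma IsCyclicEmbedding.injective (hg : IsCyclicEmbedding g) : Function.Injective g := by
  obtain ⟨h, hh⟩ := hg
  intro a b hab
  by_contra hne
  have h₁ := hh a b hne
  have h₂ := hh b a (Ne.symm hne)
  simp only [hab, lt_irrefl, if_false] at h₁ h₂
  rcases lt_or_gt_of_ne hne with hlt | hlt <;>
    simp only [hlt, hlt.not_gt, if_true, if_false] at h₁ h₂ <;> omega

/-- Around a cycle the coboundary in `IsCyclicEmbedding` cancels, so it does not affect this sum. -/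
lemma cyc_iff_sum_eq_one {a b c : α} : Cyc a c b ↔ a ≠ c ∧ c ≠ b ∧ b ≠ a ∧
    (if c < a then 1 else 0) + (if b < c then 1 else 0) + (if a < b then 1 else 0) = (1 : ℤ) := by
  simp only [Cyc]
  grind

lemma IsCyclicEmbedding.cyc_iff (hg : IsCyclicEmbedding g) {a b c : α} :
    Cyc (g a) (g c) (g b) ↔ Cyc a c b := by
  obtain ⟨h, hh⟩ := id hg
  simp only [cyc_iff_sum_eq_one, hg.injective.ne_iff]
  refine and_congr_right fun hac => and_congr_right fun hcb => and_congr_right fun hba => ?_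
  rw [hh a c hac, hh c b hcb, hh b a hba]
  exact iff_of_eq (by ring_nf)

lemma permOf_mapWord (hg : Function.Injective g) (T : Word α) (c : α) :
    permOf (mapWord g T) (g c) = g (permOf T c) := by
  induction T generalizing c with
  | nil => rfl
  | cons p T ih =>
    simp only [mapWord, List.map_cons, permOf, Perm.mul_apply, Prod.map_fst, Prod.map_snd,
      hg.swap_apply]
    exact ih _

lemma sum_swap_sub_mul [Fintype α] (ψ h : α → ℤ) (a b : α) :
    ∑ c, (ψ (swap a b c) - ψ c) * h c = (ψ b - ψ a) * (h a - h b) := by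
  rcases eq_or_ne a b with rfl | hab
  · simp
  · rw [Fintype.sum_eq_add a b hab fun c hc => by
      rw [swap_apply_of_ne_of_ne hc.1 hc.2, sub_self, zero_mul], swap_apply_left, swap_apply_right]
    ring

lemma wsum_mapWord [Fintype α] {h : α → ℤ} (hh : ∀ a b, a ≠ b →
      (if g b < g a then 1 else 0) = (if b < a then 1 else 0) + h a - h b)
    (hg : Function.Injective g) (φ : β → ℤ) (T : Word α) : wsum φ (mapWord g T) =
      wsum (φ ∘ g) T + ∑ c, (φ (g ((permOf T).symm c)) - φ (g c)) * h c := by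
  induction T generalizing φ with
  | nil => simp [mapWord, wsum, permOf, Perm.one_def]
  | cons p T ih =>
    obtain ⟨a, b⟩ := p
    have hcomp : (φ ∘ swap (g a) (g b)) ∘ g = (φ ∘ g) ∘ swap a b := by
      ext c; simp [hg.swap_apply]
    have hhead : (if g b < g a then φ (g b) - φ (g a) else 0) =
        (if b < a then φ (g b) - φ (g a) else 0) + (φ (g b) - φ (g a)) * (h a - h b) := by
      rcases eq_or_ne a b with rfl | hab
      · simp
      · have := hh a b hab
        split_ifs at this ⊢ <;> grind
    have hsum := sum_swap_sub_mul (φ ∘ g) h a b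
    have htail := ih (φ ∘ swap (g a) (g b))
    simp only [hcomp, Function.comp_apply, hg.swap_apply] at htail hsum
    have hsplit : ∑ c, (φ (g ((permOf ((a, b) :: T)).symm c)) - φ (g c)) * h c =
        ∑ c, (φ (g (swap a b ((permOf T).symm c))) - φ (g (swap a b c))) * h c +
          ∑ c, (φ (g (swap a b c)) - φ (g c)) * h c := by
      rw [← Finset.sum_add_distrib]
      refine Finset.sum_congr rfl fun c _ => ?_
      rw [show (permOf ((a, b) :: T)).symm c = swap a b ((permOf T).symm c) from rfl]
      ring
    simp only [mapWord, List.map_cons, wsum, Prod.map_fst, Prod.map_snd, hhead,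
      Function.comp_apply, hsplit, hsum] at htail ⊢
    rw [htail]
    ring

lemma SameEffect.of_mapWord [Finite α] (hg : IsCyclicEmbedding g) {S T : Word α}
    (hST : SameEffect (mapWord g S) (mapWord g T)) : SameEffect S T := by
  cases nonempty_fintype α
  have hperm : permOf S = permOf T := by
    ext c
    apply hg.injective
    rw [← permOf_mapWord hg.injective, hST.1, permOf_mapWord hg.injective]
  refine ⟨hperm, fun φ => ?_⟩
  obtain ⟨h, hh⟩ := id hg
  have hφ : Function.extend g φ 0 ∘ g = φ := funext (hg.injective.extend_apply φ 0)
  have := hST.2 (Function.extend g φ 0)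
  rwa [wsum_mapWord hh hg.injective, wsum_mapWord hh hg.injective, hperm, add_left_inj, hφ] at this

lemma Admissible.of_mapWord (hg : IsCyclicEmbedding g) {G : β → ℤ} {T : Word α}
    (h : Admissible G (mapWord g T)) : Admissible (G ∘ g) T := by
  induction T generalizing G with
  | nil => trivial
  | cons p T ih =>
    obtain ⟨⟨hleft, hright, hbetween⟩, htail⟩ := h
    refine ⟨⟨hleft, hright, fun c hc => hbetween _ (hg.cyc_iff.2 hc)⟩, ?_⟩
    convert ih htail using 1
    ext c
    simp [hg.injective.swap_apply]

lemma Admissible.mapWord (hg : IsCyclicEmbedding g) {G : β → ℤ} {T : Word α}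
    (hG : ∀ c ∉ Set.range g, ∀ x, G (g x) < G c) (h : Admissible (G ∘ g) T) :
    Admissible G (mapWord g T) := by
  induction T generalizing G with
  | nil => trivial
  | cons p T ih =>
    obtain ⟨⟨hleft, hright, hbetween⟩, htail⟩ := h
    refine ⟨⟨hleft, hright, fun c hc => ?_⟩, ih (fun c hc x => ?_) ?_⟩
    · by_cases hrange : c ∈ Set.range g
      · obtain ⟨x, rfl⟩ := hrange
        exact hbetween x (hg.cyc_iff.1 hc)
      · exact Or.inr (hG c hrange _)
    · rw [Function.comp_apply, Function.comp_apply, Prod.map_fst, Prod.map_snd,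
        hg.injective.swap_apply, swap_apply_of_ne_of_ne (fun h => hc ⟨_, h.symm⟩)
        fun h => hc ⟨_, h.symm⟩]
      exact hG c hc _
    · convert htail using 1
      ext c
      simp [hg.injective.swap_apply]

lemma BraidEquiv.mapWord (hg : IsCyclicEmbedding g) {S T : Word α} (h : BraidEquiv S T) :
    BraidEquiv (mapWord g S) (mapWord g T) := by
  induction h with
  | move h =>
    refine .move ?_
    cases h with
    | commute h => exact .commute (by simpa [DisjointOps, hg.injective.eq_iff] using h)
    | braid h hd =>
      exact .braid (hg.cyc_iff.2 h) (hd.imp (congrArg g) hg.cyc_iff.2)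
    | braid_reverse h hd =>
      exact .braid_reverse (hg.cyc_iff.2 h) (hd.imp (congrArg g) hg.cyc_iff.2)
  | append _ _ ih ih' => rw [mapWord_append, mapWord_append]; exact ih.append ih'
  | refl T => exact .refl _
  | symm _ ih => exact ih.symm
  | trans _ _ ih ih' => exact ih.trans ih'

lemma HasZeroFactor.mapWord (hg : IsCyclicEmbedding g) {T : Word α} (h : HasZeroFactor T) :
    HasZeroFactor (mapWord g T) := by
  obtain ⟨Z, hZ, A, B, rfl⟩ := h
  refine ⟨QuantumBruhat.mapWord g Z, ?_, QuantumBruhat.mapWord g A, QuantumBruhat.mapWord g B,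
    by simp only [mapWord_append]⟩
  cases hZ with
  | op a => exact .op _
  | pair h =>
    exact .pair (by simpa [ZeroPair, DisjointOps, hg.injective.eq_iff, hg.cyc_iff] using h)
  | triple h =>
    refine .triple ?_
    simpa [ZeroTriple, Prod.ext_iff, hg.injective.eq_iff, hg.cyc_iff] using h

lemma isCascade_mapWord_iff (hg : IsCyclicEmbedding g) {T : Word α} :
    IsCascade (mapWord g T) ↔ IsCascade T := by
  refine ⟨fun h => ?_, fun h => ?_⟩
  · generalize hT : mapWord g T = gT at h
    obtain ⟨h, h', h''⟩ := h
    simp only [mapWord, List.map_eq_cons_iff, List.map_eq_nil_iff, Prod.map, Prod.mk.injEq] at hT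
    obtain ⟨⟨d, a⟩, _, rfl, ⟨rfl, rfl⟩, ⟨_, b⟩, _, rfl, ⟨ha, rfl⟩, ⟨_, c⟩, _, rfl, ⟨hb, rfl⟩,
      ⟨_, e⟩, _, rfl, ⟨hc, rfl⟩, rfl⟩ := hT
    obtain rfl := hg.injective ha
    obtain rfl := hg.injective hb
    obtain rfl := hg.injective hc
    exact .mk (hg.cyc_iff.1 h) (hg.cyc_iff.1 h') (hg.cyc_iff.1 h'')
  · obtain ⟨h, h', h''⟩ := h
    exact .mk (hg.cyc_iff.2 h) (hg.cyc_iff.2 h') (hg.cyc_iff.2 h'')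

lemma isQuartic_mapWord_iff (hg : IsCyclicEmbedding g) {S T : Word α} :
    IsQuartic (mapWord g S) (mapWord g T) ↔ IsQuartic S T := by
  refine ⟨fun h => ?_, fun h => ?_⟩
  · generalize hS : mapWord g S = gS at h
    generalize hT : mapWord g T = gT at h
    obtain ⟨h, h'⟩ := h
    simp only [mapWord, List.map_eq_cons_iff, List.map_eq_nil_iff, Prod.map, Prod.mk.injEq]
      at hS hT
    obtain ⟨⟨d, a⟩, _, rfl, ⟨rfl, rfl⟩, ⟨a₁, b⟩, _, rfl, ⟨ha₁, rfl⟩, ⟨b₁, c⟩, _, rfl, ⟨hb₁, rfl⟩,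
      ⟨c₁, a₂⟩, _, rfl, ⟨hc₁, ha₂⟩, rfl⟩ := hS
    obtain ⟨⟨d₁, b₂⟩, _, rfl, ⟨hd₁, hb₂⟩, ⟨b₃, c₂⟩, _, rfl, ⟨hb₃, hc₂⟩, ⟨c₃, d₂⟩, _, rfl,
      ⟨hc₃, hd₂⟩, ⟨d₃, a₃⟩, _, rfl, ⟨hd₃, ha₃⟩, rfl⟩ := hT
    simp only [hg.injective.eq_iff] at ha₁ ha₂ ha₃ hb₁ hb₂ hb₃ hc₁ hc₂ hc₃ hd₁ hd₂ hd₃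
    subst ha₁ ha₂ ha₃ hb₁ hb₂ hb₃ hc₁ hc₂ hc₃ hd₁ hd₂ hd₃
    exact .mk (hg.cyc_iff.1 h) (hg.cyc_iff.1 h')
  · obtain ⟨h, h'⟩ := h
    exact .mk (hg.cyc_iff.2 h) (hg.cyc_iff.2 h')

end CyclicEmbeddings

section Enumeration

variable {m : ℕ}

/-- The words that differ from `[p, q]` by one `BraidMove`. -/
def pairMoves (p q : Fin m × Fin m) : List (Word (Fin m)) :=
  if DisjointOps p q then [[q, p]] else []

/-- The words that differ from `[p, q, r]` by one move `BraidMove.braid`, in either direction. -/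
def braidMoves (p q r : Fin m × Fin m) : List (Word (Fin m)) :=
  (if q.1 = p.2 ∧ r.2 = p.2 ∧ Cyc p.1 p.2 q.2 ∧ (r.1 = q.2 ∨ Cyc q.2 r.1 p.1) then
    [[(p.1, q.2), (r.1, p.1), (p.1, p.2)]] else []) ++
  if q.2 = p.1 ∧ r.1 = p.1 ∧ Cyc p.1 r.2 p.2 ∧ (q.1 = p.2 ∨ Cyc p.2 q.1 p.1) then
    [[(p.1, r.2), (r.2, p.2), (q.1, r.2)]] else []

/-- The words that differ from `[p, q, r]` by one `BraidMove` of length three. -/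
def tripleMoves (p q r : Fin m × Fin m) : List (Word (Fin m)) :=
  braidMoves p q r ++ (braidMoves r q p).map List.reverse

/-- The words that differ from the given one by a `BraidMove` of its first operators. -/
def headMoves : Word (Fin m) → List (Word (Fin m))
  | p :: q :: T => (pairMoves p q).map (· ++ T) ++
      match T with
      | [] => []
      | r :: T => (tripleMoves p q r).map (· ++ T)
  | _ => []

/-- The words that differ from the given one by a `BraidMove` of consecutive operators. -/
def neighbors : Word (Fin m) → List (Word (Fin m))
  | [] => []
  | p :: T => headMoves (p :: T) ++ (neighbors T).map (p :: ·)

/-- Some consecutive operators of the word satisfy `ZeroPair` or `ZeroTriple`. -/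
def hasZeroFactor : Word (Fin m) → Bool
  | [] => false
  | p :: T => hasZeroFactor T ||
      match T with
      | [] => false
      | q :: T => ZeroPair p q ||
          match T with
          | [] => false
          | r :: _ => ZeroTriple p q r

/-- At most `k` moves lead from the word to one with a zero factor. -/
def reachesZeroFactor : ℕ → Word (Fin m) → Bool
  | 0, T => hasZeroFactor T
  | k + 1, T => hasZeroFactor T || (neighbors T).any (reachesZeroFactor k)

/-- At most `k` moves lead from some word of the list to `T`. -/
def reachable (T : Word (Fin m)) : ℕ → List (Word (Fin m)) → Bool
  | 0, L => T ∈ L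
  | k + 1, L => T ∈ L || reachable T k (L.flatMap neighbors)

/-- The word as a number in base `m`, the last operator being the most significant. -/
def code : Word (Fin m) → ℕ
  | [] => 0
  | p :: T => m * p.1 + p.2 + m * m * code T

/-- The operators `v_{ab}`, `a ≠ b`. -/
def operators (m : ℕ) : List (Fin m × Fin m) :=
  (List.finRange m ×ˢ List.finRange m).filter fun p => p.1 ≠ p.2

/-- The operators `p` for which `[p, q]` is not zero and has the least code among its neighbors. -/
def pairHeads (q : Fin m × Fin m) : List (Fin m × Fin m) :=
  (operators m).filter fun p => ¬ ZeroPair p q ∧ ∀ X ∈ pairMoves p q, code [p, q] ≤ code X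

/-- The operators `p` for which `[p, q, r]` has no zero factor that contains `p`, and cannot
be replaced by a word with smaller code by a move that involves `p`. -/
def tripleHeads (q r : Fin m × Fin m) : List (Fin m × Fin m) :=
  (pairHeads q).filter fun p =>
    ¬ ZeroTriple p q r ∧ ∀ X ∈ tripleMoves p q r, code [p, q, r] ≤ code X

/-- The operators that may precede the given word. -/
def heads : Word (Fin m) → List (Fin m × Fin m)
  | [] => (operators m).filter fun p => p.1.val = 0
  | [q] => pairHeads q
  | q :: r :: _ => tripleHeads q r

/-- The indices that do not occur in the word. -/
def missing : Word (Fin m) → List (Fin m)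
  | [] => List.finRange m
  | p :: T => (missing T).filter fun c => p.1 ≠ c ∧ p.2 ≠ c

/-- The words `p :: T` in which at most `d` indices are missing. -/
def extend (d : ℕ) (T : Word (Fin m)) : List (Word (Fin m)) :=
  ((heads T).map (· :: T)).filter fun X => (missing X).length ≤ d

/-- The words of length four in which all indices occur, up to moves and cyclic shifts. -/
def reducedWords (m : ℕ) : List (Word (Fin m)) :=
  (((extend 6 []).flatMap (extend 4)).flatMap (extend 2)).flatMap (extend 0)

/-- The reduced words that are not recognized as zero by means of few moves. -/
def nonzeroWords (m : ℕ) : List (Word (Fin m)) :=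
  (reducedWords m).filter fun T => !reachesZeroFactor 3 T

/-- The value `c` has to start on the right. -/
def startsRight : Word (Fin m) → Fin m → Bool
  | [], _ => false
  | p :: T, c => p.1 ≠ c ∧ (p.2 = c ∨ startsRight T c)

/-- The number of operators that pass over the position at which the value `c` starts. -/
def passes : Word (Fin m) → Fin m → ℕ
  | [], _ => 0
  | p :: T, c => (if Cyc p.1 c p.2 then 1 else 0) + passes T (swap p.1 p.2 c)

/-- Places to which no operator of the word ought to object: the more operators pass over a
position, the further out it lies. -/
def testPlaces (T : Word (Fin m)) (c : Fin m) : ℤ :=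
  if startsRight T c then m * passes T c + c else c - m * (passes T c + 1)

instance decidableCanApply (F : Fin m → ℤ) (p : Fin m × Fin m) : Decidable (CanApply F p) :=
  have : Decidable (∀ c, Cyc p.1 c p.2 → F c < F p.1 ∨ F p.2 < F c) := Nat.decidableForallFin _
  inferInstanceAs (Decidable (_ ∧ _ ∧ _))

instance decidableAdmissible : ∀ (F : Fin m → ℤ) (T : Word (Fin m)), Decidable (Admissible F T)
  | _, [] => isTrue trivial
  | F, p :: T =>
    have := decidableAdmissible (F ∘ swap p.1 p.2) T
    inferInstanceAs (Decidable (_ ∧ _))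

/-- The cyclic shift of all indices by `j`. -/
def rotate [NeZero m] (j : Fin m) (T : Word (Fin m)) : Word (Fin m) := mapWord (· + j) T

/-- The displacements `w(c) - c` of the permutation of a word, encoded by their multiplicities. They
are invariant under `rotate`, and are compared first to speed up the enumeration. -/
def displacementCode [NeZero m] (T : Word (Fin m)) : ℕ := ∑ c, 9 ^ (permOf T c - c).val

/-- The permutation of a word as a number in base `m`. -/
def permCode (T : Word (Fin m)) : ℕ := ∑ c, (permOf T c).val * m ^ c.val

/-- A weight whose `wsum` tells the powers of `q` of short words apart. -/
def powerWeight (c : Fin m) : ℤ := 9 ^ c.val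

/-- The words of the enumeration that vanish and are not recognized as zero are among `Z`. -/
def VanishingWordsIn (m : ℕ) (Z : List (Word (Fin m))) : Prop :=
  ∀ T ∈ nonzeroWords m, Admissible (testPlaces T) T ∨ T ∈ Z

/-- The pairs of words of the enumeration that have the same effect, up to cyclic shifts, and are
not recognized as equivalent by means of few moves are among `Q`. -/
def EquivalentPairsIn (m : ℕ) [NeZero m] (Q : List (Word (Fin m) × Word (Fin m))) : Prop :=
  ∀ S ∈ nonzeroWords m, ∀ T ∈ nonzeroWords m, displacementCode S = displacementCode T → ∀ j,
    permCode S = permCode (rotate j T) → wsum powerWeight S = wsum powerWeight (rotate j T) →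
    reachable S 4 [rotate j T] ∨ (S, rotate j T) ∈ Q

instance (m : ℕ) (Z : List (Word (Fin m))) : Decidable (VanishingWordsIn m Z) :=
  inferInstanceAs (Decidable (∀ T ∈ nonzeroWords m, _))

instance (m : ℕ) [NeZero m] (Q : List (Word (Fin m) × Word (Fin m))) :
    Decidable (EquivalentPairsIn m Q) :=
  inferInstanceAs (Decidable (∀ S ∈ nonzeroWords m, _))

lemma enumeration_one : VanishingWordsIn 1 [] ∧ EquivalentPairsIn 1 [] := by decide +kernel

lemma enumeration_two : VanishingWordsIn 2 [] ∧ EquivalentPairsIn 2 [] := by decide +kernel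

lemma enumeration_three : VanishingWordsIn 3 [] ∧ EquivalentPairsIn 3 [] := by decide +kernel

lemma enumeration_four : VanishingWordsIn 4 [] ∧ EquivalentPairsIn 4
    [([(1, 2), (2, 3), (3, 0), (0, 2)], [(1, 3), (3, 0), (0, 1), (1, 2)]),
      ([(0, 2), (2, 3), (3, 0), (0, 1)], [(0, 1), (1, 2), (2, 3), (3, 1)]),
      ([(0, 1), (3, 0), (2, 3), (0, 2)], [(3, 1), (2, 3), (1, 2), (0, 1)]),
      ([(3, 1), (2, 3), (1, 2), (0, 1)], [(0, 1), (3, 0), (2, 3), (0, 2)])] := by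
  decide +kernel

lemma enumeration_five : VanishingWordsIn 5
    [[(1, 3), (3, 4), (4, 0), (0, 2)], [(4, 1), (3, 4), (2, 3), (0, 2)]] ∧
    EquivalentPairsIn 5 [] := by
  decide +kernel

lemma enumeration_six : VanishingWordsIn 6 [] ∧ EquivalentPairsIn 6 [] := by decide +kernel

lemma enumeration_seven : VanishingWordsIn 7 [] ∧ EquivalentPairsIn 7 [] := by decide +kernel

lemma enumeration_eight : VanishingWordsIn 8 [] ∧ EquivalentPairsIn 8 [] := by decide +kernel

end Enumeration

section Soundness

variable {α : Type*} [LinearOrder α] {m : ℕ}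

lemma BraidEquiv.reverse {S T : Word α} (h : BraidEquiv S T) :
    BraidEquiv S.reverse T.reverse := by
  induction h with
  | move h =>
    cases h with
    | commute h => exact .symm (.move (.commute h))
    | braid h hd => exact .move (.braid_reverse h hd)
    | braid_reverse h hd => exact .move (.braid h hd)
  | append _ _ ih ih' => rw [List.reverse_append, List.reverse_append]; exact ih'.append ih
  | refl T => exact .refl _
  | symm _ ih => exact ih.symm
  | trans _ _ ih ih' => exact ih.trans ih'

lemma BraidEquiv.cons {S T : Word α} (p : α × α) (h : BraidEquiv S T) :
    BraidEquiv (p :: S) (p :: T) :=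
  (BraidEquiv.refl [p]).append h

lemma braidEquiv_of_mem_pairMoves {p q : Fin m × Fin m} {X : Word (Fin m)}
    (hX : X ∈ pairMoves p q) : BraidEquiv [p, q] X := by
  unfold pairMoves at hX
  split_ifs at hX with h
  · rw [List.mem_singleton.1 hX]
    exact .move (.commute h)
  · exact absurd hX List.not_mem_nil

lemma braidEquiv_of_mem_braidMoves {p q r : Fin m × Fin m} {X : Word (Fin m)}
    (hX : X ∈ braidMoves p q r) : BraidEquiv [p, q, r] X := by
  obtain ⟨a, b⟩ := p
  obtain ⟨c, d⟩ := q
  obtain ⟨e, f⟩ := r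
  simp only [braidMoves, List.mem_append, List.mem_ite_nil_right, List.mem_singleton] at hX
  rcases hX with ⟨⟨rfl, rfl, h, hd⟩, rfl⟩ | ⟨⟨rfl, rfl, h, hd⟩, rfl⟩
  · exact .move (.braid h hd)
  · exact (BraidEquiv.move (.braid h hd)).symm

lemma braidEquiv_of_mem_tripleMoves {p q r : Fin m × Fin m} {X : Word (Fin m)}
    (hX : X ∈ tripleMoves p q r) : BraidEquiv [p, q, r] X := by
  rcases List.mem_append.1 hX with h | h
  · exact braidEquiv_of_mem_braidMoves h
  · obtain ⟨Y, hY, rfl⟩ := List.mem_map.1 h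
    exact (braidEquiv_of_mem_braidMoves hY).reverse

lemma braidEquiv_of_mem_headMoves {T X : Word (Fin m)} (hX : X ∈ headMoves T) :
    BraidEquiv T X := by
  match T with
  | [] | [_] => exact absurd hX List.not_mem_nil
  | [p, q] =>
    simp only [headMoves, List.append_nil, List.map_id'] at hX
    exact braidEquiv_of_mem_pairMoves hX
  | p :: q :: r :: T =>
    rcases List.mem_append.1 hX with h | h <;> obtain ⟨Y, hY, rfl⟩ := List.mem_map.1 h
    · exact (braidEquiv_of_mem_pairMoves hY).append (.refl (r :: T))
    · exact (braidEquiv_of_mem_tripleMoves hY).append (.refl T)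

lemma braidEquiv_of_mem_neighbors {T X : Word (Fin m)} (hX : X ∈ neighbors T) :
    BraidEquiv T X := by
  induction T generalizing X with
  | nil => exact absurd hX List.not_mem_nil
  | cons p T ih =>
    rcases List.mem_append.1 hX with h | h
    · exact braidEquiv_of_mem_headMoves h
    · obtain ⟨Y, hY, rfl⟩ := List.mem_map.1 h
      exact (ih hY).cons p

lemma hasZeroFactor_sound {T : Word (Fin m)} (hT : hasZeroFactor T) : HasZeroFactor T := by
  induction T with
  | nil => exact absurd hT Bool.false_ne_true
  | cons p T ih =>
    rcases Bool.or_eq_true_iff.1 hT with h | h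
    · obtain ⟨Z, hZ, hZT⟩ := ih h
      exact ⟨Z, hZ, List.infix_cons hZT⟩
    · match T with
      | [] => exact absurd h Bool.false_ne_true
      | [q] =>
        simp only [Bool.or_false, decide_eq_true_eq] at h
        exact ⟨_, .pair h, List.infix_refl _⟩
      | q :: r :: T =>
        simp only [Bool.or_eq_true, decide_eq_true_eq] at h
        rcases h with h | h
        · exact ⟨_, .pair h, (List.prefix_append [p, q] (r :: T)).isInfix⟩
        · exact ⟨_, .triple h, (List.prefix_append [p, q, r] T).isInfix⟩

lemma reachesZeroFactor_sound {T : Word (Fin m)} {k : ℕ} (hT : reachesZeroFactor k T) :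
    ∃ X, BraidEquiv T X ∧ HasZeroFactor X := by
  induction k generalizing T with
  | zero => exact ⟨T, .refl T, hasZeroFactor_sound hT⟩
  | succ k ih =>
    rcases Bool.or_eq_true_iff.1 hT with h | h
    · exact ⟨T, .refl T, hasZeroFactor_sound h⟩
    · obtain ⟨Y, hY, hYk⟩ := List.any_eq_true.1 h
      obtain ⟨X, hX, hzero⟩ := ih hYk
      exact ⟨X, (braidEquiv_of_mem_neighbors hY).trans hX, hzero⟩

lemma reachable_sound {T : Word (Fin m)} {k : ℕ} {L : List (Word (Fin m))}
    (hT : reachable T k L) : ∃ X ∈ L, BraidEquiv X T := by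
  induction k generalizing L with
  | zero => exact ⟨T, of_decide_eq_true hT, .refl T⟩
  | succ k ih =>
    rcases Bool.or_eq_true_iff.1 hT with h | h
    · exact ⟨T, of_decide_eq_true h, .refl T⟩
    · obtain ⟨Y, hY, hYT⟩ := ih h
      obtain ⟨X, hX, hXY⟩ := List.mem_flatMap.1 hY
      exact ⟨X, hX, (braidEquiv_of_mem_neighbors hXY).trans hYT⟩

lemma testPlaces_injective (T : Word (Fin m)) : Function.Injective (testPlaces T) := by
  have hmod (c : Fin m) : testPlaces T c % m = c := by
    unfold testPlaces
    split_ifs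
    · rw [add_comm, Int.add_mul_emod_self_left, Int.emod_eq_of_lt] <;> omega
    · rw [Int.sub_mul_emod_self_left, Int.emod_eq_of_lt] <;> omega
  intro c d hcd
  have := (hmod c).symm.trans ((congrArg (· % (m : ℤ)) hcd).trans (hmod d))
  exact Fin.ext (by exact_mod_cast this)

end Soundness

section Letters

variable {α : Type*} [LinearOrder α]

/-- The set of indices that occur in a word. -/
def letters (T : Word α) : Finset α := T.toFinset.biUnion fun p => {p.1, p.2}

lemma mem_letters {T : Word α} {c : α} : c ∈ letters T ↔ ∃ p ∈ T, c = p.1 ∨ c = p.2 := by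
  simp [letters]

lemma letters_append (S T : Word α) : letters (S ++ T) = letters S ∪ letters T := by
  simp [letters, Finset.union_biUnion]

lemma letters_mapWord {β : Type*} [LinearOrder β] (g : α → β) (T : Word α) :
    letters (mapWord g T) = (letters T).image g := by
  ext c
  simp only [mem_letters, mapWord, List.mem_map, Finset.mem_image]
  grind

lemma BraidEquiv.letters_eq {S T : Word α} (h : BraidEquiv S T) : letters S = letters T := by
  induction h with
  | move h =>
    cases h <;> ext <;> simp only [mem_letters, List.mem_cons, List.not_mem_nil, or_false,
      exists_eq_or_imp, exists_eq_left] <;> tauto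
  | append _ _ ih ih' => rw [letters_append, letters_append, ih, ih']
  | refl T => rfl
  | symm _ ih => exact ih.symm
  | trans _ _ ih ih' => exact ih.trans ih'

lemma BraidEquiv.length_eq {S T : Word α} (h : BraidEquiv S T) : S.length = T.length := by
  induction h with
  | move h => cases h <;> rfl
  | append _ _ ih ih' => rw [List.length_append, List.length_append, ih, ih']
  | refl T => rfl
  | symm _ ih => exact ih.symm
  | trans _ _ ih ih' => exact ih.trans ih'

end Letters

section Completeness

variable {m : ℕ}

lemma code_append (S T : Word (Fin m)) :
    code (S ++ T) = code S + (m * m) ^ S.length * code T := by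
  induction S with
  | nil => simp [code]
  | cons p S ih => simp only [List.cons_append, code, ih, List.length_cons]; ring

lemma code_append_le_code_append_iff (A B : Word (Fin m)) {X Y : Word (Fin m)}
    (hlen : X.length = Y.length) (hm : 0 < m) :
    code (A ++ X ++ B) ≤ code (A ++ Y ++ B) ↔ code X ≤ code Y := by
  have hpow : 0 < (m * m) ^ A.length := by positivity
  rw [code_append, code_append, code_append, code_append, List.length_append, List.length_append,
    hlen, Nat.add_le_add_iff_right, Nat.add_le_add_iff_left, Nat.mul_le_mul_left_iff hpow]

lemma code_lt (T : Word (Fin m)) : code T < (m * m) ^ T.length := by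
  induction T with
  | nil => simp [code]
  | cons p T ih =>
    have hp : m * p.1.val + p.2.val < m * m := by nlinarith [p.1.isLt, p.2.isLt]
    simp only [code, List.length_cons, pow_succ]
    nlinarith

lemma missing_nodup (T : Word (Fin m)) : (missing T).Nodup := by
  induction T with
  | nil => exact List.nodup_finRange m
  | cons p T ih => exact ih.filter _

lemma mem_missing {T : Word (Fin m)} {c : Fin m} : c ∈ missing T ↔ c ∉ letters T := by
  induction T with
  | nil => simp [missing, letters]
  | cons p T ih =>
    simp only [missing, List.mem_filter, ih, mem_letters, decide_eq_true_eq, List.mem_cons]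
    grind

lemma length_missing_le (p : Fin m × Fin m) (T : Word (Fin m)) :
    (missing T).length ≤ (missing (p :: T)).length + 2 := by
  have hsub : missing T ⊆ p.1 :: p.2 :: missing (p :: T) := by
    intro c hc
    simp only [missing, List.mem_cons, List.mem_filter, decide_eq_true_eq]
    grind
  exact ((missing_nodup T).subperm hsub).length_le

/-- All indices occur in the word, it has no zero factor, its last operator is `(0, _)`, and no
`BraidMove` of its operators leads to a smaller code. -/
structure IsReduced (T : Word (Fin m)) : Prop where
  letters_eq : letters T = Finset.univ
  not_hasZeroFactor : ¬ HasZeroFactor T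
  code_le : ∀ A X B, T = A ++ X ++ B → ∀ Y, BraidEquiv X Y → code X ≤ code Y
  getLast_fst : ∀ A p, T = A ++ [p] → p.1.val = 0

lemma mem_operators {p : Fin m × Fin m} : p ∈ operators m ↔ p.1 ≠ p.2 := by
  obtain ⟨a, b⟩ := p
  simp [operators]

lemma IsReduced.fst_ne_snd {A B : Word (Fin m)} {p : Fin m × Fin m}
    (hT : IsReduced (A ++ p :: B)) : p.1 ≠ p.2 := by
  obtain ⟨a, b⟩ := p
  rintro (rfl : a = b)
  exact hT.not_hasZeroFactor ⟨_, .op a, A, B, by simp⟩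

lemma mem_pairHeads {A B : Word (Fin m)} {p q : Fin m × Fin m}
    (hT : IsReduced (A ++ [p, q] ++ B)) : p ∈ pairHeads q := by
  simp only [pairHeads, List.mem_filter, mem_operators, decide_eq_true_eq]
  exact ⟨IsReduced.fst_ne_snd (A := A) (B := q :: B) (by simpa using hT),
    fun h => hT.not_hasZeroFactor ⟨_, .pair h, A, B, rfl⟩,
    fun X hX => hT.code_le A _ B rfl X (braidEquiv_of_mem_pairMoves hX)⟩

lemma mem_tripleHeads {A B : Word (Fin m)} {p q r : Fin m × Fin m}
    (hT : IsReduced (A ++ [p, q, r] ++ B)) : p ∈ tripleHeads q r := by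
  simp only [tripleHeads, List.mem_filter, decide_eq_true_eq]
  exact ⟨mem_pairHeads (A := A) (B := r :: B) (by simpa using hT),
    fun h => hT.not_hasZeroFactor ⟨_, .triple h, A, B, rfl⟩,
    fun X hX => hT.code_le A _ B rfl X (braidEquiv_of_mem_tripleMoves hX)⟩

lemma mem_heads_of_isReduced {A T : Word (Fin m)} {p : Fin m × Fin m}
    (hT : IsReduced (A ++ p :: T)) : p ∈ heads T := by
  match T with
  | [] => exact List.mem_filter.2 ⟨mem_operators.2 hT.fst_ne_snd,
      decide_eq_true (hT.getLast_fst A p rfl)⟩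
  | [q] => exact mem_pairHeads (A := A) (B := []) (by simpa using hT)
  | q :: r :: T => exact mem_tripleHeads (A := A) (B := T) (by simpa using hT)

lemma mem_reducedWords {T : Word (Fin m)} (hT : IsReduced T) (hlen : T.length = 4) :
    T ∈ reducedWords m := by
  obtain ⟨p, q, r, s, rfl⟩ := List.length_eq_four.1 hlen
  have hmissing : (missing [p, q, r, s]).length = 0 :=
    List.length_eq_zero_iff.2 (List.eq_nil_iff_forall_not_mem.2 fun c hc =>
      mem_missing.1 hc (hT.letters_eq ▸ Finset.mem_univ c))
  have hp := length_missing_le p [q, r, s]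
  have hq := length_missing_le q [r, s]
  have hr := length_missing_le r [s]
  have hextend {d : ℕ} {A T : Word (Fin m)} {x : Fin m × Fin m} (h : IsReduced (A ++ x :: T))
      (hd : (missing (x :: T)).length ≤ d) : x :: T ∈ extend d T :=
    List.mem_filter.2 ⟨List.mem_map_of_mem (mem_heads_of_isReduced h), decide_eq_true hd⟩
  simp only [reducedWords, List.mem_flatMap]
  exact ⟨[q, r, s], ⟨[r, s], ⟨[s], hextend (A := [p, q, r]) hT (by omega),
    hextend (A := [p, q]) hT (by omega)⟩, hextend (A := [p]) hT (by omega)⟩,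
    hextend (A := []) hT (by omega)⟩

end Completeness

section Exceptional

variable {α β : Type*} [LinearOrder α] [LinearOrder β] {g : α → β}

/-- The compositions of the zero equivalence of degree four, up to the transformations. -/
def IsExceptionalZero (T : Word α) : Prop := IsCascade T ∨ IsCascade T.reverse

/-- The two sides of the non-zero equivalence of degree four, up to the transformations. -/
def IsExceptionalPair (S T : Word α) : Prop :=
  (IsQuartic S T ∨ IsQuartic T S) ∨ IsQuartic S.reverse T.reverse ∨ IsQuartic T.reverse S.reverse

lemma isExceptionalZero_mapWord_iff (hg : IsCyclicEmbedding g) {T : Word α} :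
    IsExceptionalZero (mapWord g T) ↔ IsExceptionalZero T := by
  rw [IsExceptionalZero, ← mapWord_reverse, isCascade_mapWord_iff hg, isCascade_mapWord_iff hg,
    IsExceptionalZero]

lemma isExceptionalPair_mapWord_iff (hg : IsCyclicEmbedding g) {S T : Word α} :
    IsExceptionalPair (mapWord g S) (mapWord g T) ↔ IsExceptionalPair S T := by
  simp only [IsExceptionalPair, ← mapWord_reverse, isQuartic_mapWord_iff hg]

lemma isCyclicEmbedding_add_right {m : ℕ} (j : Fin m) : IsCyclicEmbedding (· + j) := by
  refine ⟨fun c => if m ≤ c.val + j.val then -1 else 0, fun a b hab => ?_⟩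
  have := Fin.val_ne_of_ne hab
  simp only [Fin.lt_def, Fin.val_add_eq_ite]
  grind

end Exceptional

section Classification

variable {m : ℕ} [NeZero m]

lemma rotate_rotate (i j : Fin m) (T : Word (Fin m)) :
    rotate i (rotate j T) = rotate (j + i) T := by
  rw [rotate, rotate, mapWord_mapWord, rotate]
  congr 1
  ext c
  simp [add_assoc]

lemma rotate_zero (T : Word (Fin m)) : rotate 0 T = T := by simp [rotate, mapWord]

lemma rotate_neg_rotate (j : Fin m) (T : Word (Fin m)) : rotate (-j) (rotate j T) = T := by
  rw [rotate_rotate, add_neg_cancel, rotate_zero]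

lemma letters_rotate {T : Word (Fin m)} (hT : letters T = Finset.univ) (j : Fin m) :
    letters (rotate j T) = Finset.univ := by
  rw [rotate, letters_mapWord, hT]
  exact Finset.image_univ_of_surjective (add_right_surjective j)

lemma BraidEquiv.rotate {S T : Word (Fin m)} (h : BraidEquiv S T) (j : Fin m) :
    BraidEquiv (rotate j S) (rotate j T) :=
  h.mapWord (isCyclicEmbedding_add_right j)

lemma SameEffect.rotate {S T : Word (Fin m)} (h : SameEffect S T) (j : Fin m) :
    SameEffect (rotate j S) (rotate j T) := by
  refine SameEffect.of_mapWord (isCyclicEmbedding_add_right (-j)) ?_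
  have hneg (T : Word (Fin m)) : mapWord (· + -j) (QuantumBruhat.rotate j T) = T :=
    rotate_neg_rotate j T
  rwa [hneg, hneg]

lemma displacementCode_rotate (j : Fin m) (T : Word (Fin m)) :
    displacementCode (rotate j T) = displacementCode T := by
  refine (Fintype.sum_equiv (Equiv.addRight j) _ _ fun c => ?_).symm
  rw [coe_addRight, rotate, permOf_mapWord (isCyclicEmbedding_add_right j).injective,
    add_sub_add_right_eq_sub]

lemma code_rotate_neg_lt {T : Word (Fin m)} {p : Fin m × Fin m} (hp : p.1.val ≠ 0) :
    code (rotate (-p.1) (T ++ [p])) < code (T ++ [p]) := by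
  have hlt := code_lt (rotate (-p.1) T)
  have hlen : (rotate (-p.1) T).length = T.length := by simp [rotate, mapWord]
  have hsnd : m * (p.1 + -p.1).val + (p.2 + -p.1).val < m * p.1.val + p.2.val := by
    rw [add_neg_cancel, Fin.val_zero, mul_zero, zero_add]
    nlinarith [(p.2 + -p.1).isLt, Nat.pos_of_ne_zero hp]
  rw [rotate, mapWord_append, ← rotate, code_append, code_append, hlen]
  simp only [mapWord, List.map_cons, List.map_nil, code, Prod.map_fst, Prod.map_snd, mul_zero,
    add_zero]
  rw [hlen] at hlt
  nlinarith

lemma exists_reduced {V : Word (Fin m)} (hV : letters V = Finset.univ) (hlen : V.length = 4) :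
    ∃ j W, BraidEquiv (rotate j V) W ∧ (HasZeroFactor W ∨ W ∈ reducedWords m) := by
  obtain ⟨⟨j, W⟩, hW, hmin⟩ := (measure fun x : Fin m × Word (Fin m) => code x.2).wf.has_min
    {x | BraidEquiv (rotate x.1 V) x.2} ⟨(0, rotate 0 V), .refl _⟩
  have hmin {i : Fin m} {X : Word (Fin m)} (hX : BraidEquiv (rotate i V) X) : code W ≤ code X :=
    not_lt.1 (hmin (i, X) hX)
  have hlenW : W.length = 4 := by rw [← hW.length_eq, rotate, mapWord, List.length_map, hlen]
  refine ⟨j, W, hW, or_iff_not_imp_left.2 fun hzero => mem_reducedWords ⟨?_, hzero, ?_, ?_⟩ hlenW⟩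
  · rw [← hW.letters_eq, letters_rotate hV]
  · rintro A X B rfl Y hXY
    rw [← code_append_le_code_append_iff A B hXY.length_eq (NeZero.pos m)]
    exact hmin (hW.trans (((BraidEquiv.refl A).append hXY).append (.refl B)))
  · rintro A p rfl
    by_contra hp
    have := hW.rotate (-p.1)
    rw [rotate_rotate] at this
    exact (code_rotate_neg_lt hp).not_ge (hmin this)

lemma exists_nonzeroWord {V : Word (Fin m)} (hV : letters V = Finset.univ)
    (hlen : V.length = 4) :
    ∃ j W, BraidEquiv (rotate j V) W ∧ (HasZeroFactor W ∨ W ∈ nonzeroWords m) := by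
  obtain ⟨j, W, hW, hzero | hred⟩ := exists_reduced hV hlen
  · exact ⟨j, W, hW, Or.inl hzero⟩
  by_cases h : reachesZeroFactor 3 W
  · obtain ⟨X, hX, hzero⟩ := reachesZeroFactor_sound h
    exact ⟨j, X, hW.trans hX, Or.inl hzero⟩
  · exact ⟨j, W, hW, Or.inr (List.mem_filter.2 ⟨hred, by simpa using h⟩)⟩

lemma BraidEquiv.of_rotate {j : Fin m} {V W : Word (Fin m)}
    (h : BraidEquiv (QuantumBruhat.rotate j V) W) :
    BraidEquiv V (QuantumBruhat.rotate (-j) W) := by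
  have := h.rotate (-j)
  rwa [rotate_neg_rotate] at this

lemma admissible_or_isExceptionalZero (hm : m ≤ 8) {T : Word (Fin m)} (hT : T ∈ nonzeroWords m) :
    Admissible (testPlaces T) T ∨ IsExceptionalZero T := by
  have hnone (h : VanishingWordsIn m []) : Admissible (testPlaces T) T ∨ IsExceptionalZero T :=
    (h T hT).imp_right fun h => absurd h List.not_mem_nil
  have hpos := NeZero.pos m
  interval_cases m
  · exact hnone enumeration_one.1
  · exact hnone enumeration_two.1
  · exact hnone enumeration_three.1
  · exact hnone enumeration_four.1
  · refine (enumeration_five.1 T hT).imp_right fun h => ?_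
    simp only [List.mem_cons, List.not_mem_nil, or_false] at h
    rcases h with rfl | rfl
    · exact Or.inl (.mk (by decide) (by decide) (by decide))
    · exact Or.inr (.mk (by decide) (by decide) (by decide))
  · exact hnone enumeration_six.1
  · exact hnone enumeration_seven.1
  · exact hnone enumeration_eight.1

lemma braidEquiv_or_isExceptionalPair (hm : m ≤ 8) {S T : Word (Fin m)} {j : Fin m}
    (hS : S ∈ nonzeroWords m) (hT : T ∈ nonzeroWords m) (hST : SameEffect S (rotate j T)) :
    BraidEquiv S (rotate j T) ∨ IsExceptionalPair S (rotate j T) := by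
  have hcheck {Q : List (Word (Fin m) × Word (Fin m))} (h : EquivalentPairsIn m Q) :
      BraidEquiv S (rotate j T) ∨ (S, rotate j T) ∈ Q := by
    refine (h S hS T hT ?_ j ?_ (hST.2 _)).imp_left fun hreach => ?_
    · rw [← displacementCode_rotate j T, displacementCode, hST.1, displacementCode]
    · rw [permCode, hST.1, permCode]
    · obtain ⟨X, hX, hXS⟩ := reachable_sound hreach
      exact List.mem_singleton.1 hX ▸ hXS.symm
  have hnone (h : EquivalentPairsIn m []) :
      BraidEquiv S (rotate j T) ∨ IsExceptionalPair S (rotate j T) :=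
    (hcheck h).imp_right fun h => absurd h List.not_mem_nil
  have hpos := NeZero.pos m
  interval_cases m
  · exact hnone enumeration_one.2
  · exact hnone enumeration_two.2
  · exact hnone enumeration_three.2
  · refine (hcheck enumeration_four.2).imp_right fun h => ?_
    generalize rotate j T = R at h
    simp only [List.mem_cons, List.not_mem_nil, or_false, Prod.mk.injEq] at h
    rcases h with ⟨rfl, rfl⟩ | ⟨rfl, rfl⟩ | ⟨rfl, rfl⟩ | ⟨rfl, rfl⟩
    · exact Or.inl (Or.inl (.mk (by decide) (by decide)))
    · exact Or.inl (Or.inr (.mk (by decide) (by decide)))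
    · exact Or.inr (Or.inr (.mk (by decide) (by decide)))
    · exact Or.inr (Or.inl (.mk (by decide) (by decide)))
  · exact hnone enumeration_five.2
  · exact hnone enumeration_six.2
  · exact hnone enumeration_seven.2
  · exact hnone enumeration_eight.2

theorem admissible_or_braidEquiv_of_letters_eq_univ (hm : m ≤ 8) {V : Word (Fin m)}
    (hV : letters V = Finset.univ) (hlen : V.length = 4) :
    (∃ F : Fin m → ℤ, Function.Injective F ∧ Admissible F V) ∨
      ∃ X, BraidEquiv V X ∧ (HasZeroFactor X ∨ IsExceptionalZero X) := by
  obtain ⟨j, W, hW, hzero | hred⟩ := exists_nonzeroWord hV hlen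
  · exact Or.inr ⟨_, hW.of_rotate, Or.inl (hzero.mapWord (isCyclicEmbedding_add_right _))⟩
  rcases admissible_or_isExceptionalZero hm hred with h | h
  · exact Or.inl ⟨_, (testPlaces_injective W).comp (isCyclicEmbedding_add_right j).injective,
      Admissible.of_mapWord (isCyclicEmbedding_add_right j) ((hW.wordEquiv.1 _).2 h)⟩
  · exact Or.inr ⟨_, hW.of_rotate,
      Or.inr ((isExceptionalZero_mapWord_iff (isCyclicEmbedding_add_right _)).2 h)⟩

theorem braidEquiv_of_sameEffect_of_letters_eq_univ (hm : m ≤ 8) {U V : Word (Fin m)}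
    (hU : letters U = Finset.univ) (hV : letters V = Finset.univ) (hlenU : U.length = 4)
    (hlenV : V.length = 4) (hUV : SameEffect U V) :
    ∃ X Y, BraidEquiv U X ∧ BraidEquiv V Y ∧
      (HasZeroFactor X ∨ HasZeroFactor Y ∨ X = Y ∨ IsExceptionalPair X Y) := by
  obtain ⟨i, S, hS, hzeroS | hredS⟩ := exists_nonzeroWord hU hlenU
  · exact ⟨_, V, hS.of_rotate, .refl V,
      Or.inl (hzeroS.mapWord (isCyclicEmbedding_add_right _))⟩
  obtain ⟨j, T, hT, hzeroT | hredT⟩ := exists_nonzeroWord hV hlenV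
  · exact ⟨U, _, .refl U, hT.of_rotate,
      Or.inr (Or.inl (hzeroT.mapWord (isCyclicEmbedding_add_right _)))⟩
  have hVT : BraidEquiv (rotate i V) (rotate (-j + i) T) := by
    rw [← rotate_rotate]
    exact hT.of_rotate.rotate i
  have hST : SameEffect S (rotate (-j + i) T) :=
    (hS.wordEquiv.2.symm.trans (hUV.rotate i)).trans hVT.wordEquiv.2
  rcases braidEquiv_or_isExceptionalPair hm hredS hredT hST with h | h
  · exact ⟨_, _, hS.of_rotate, hVT.of_rotate.trans (h.symm.rotate (-i)),
      Or.inr (Or.inr (Or.inl rfl))⟩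
  · exact ⟨_, _, hS.of_rotate, hVT.of_rotate, Or.inr (Or.inr (Or.inr
      ((isExceptionalPair_mapWord_iff (isCyclicEmbedding_add_right _)).2 h)))⟩

end Classification

section UnionOfLetters

variable {α β : Type*} [LinearOrder α] [LinearOrder β]

lemma letters_reverse (T : Word α) : letters T.reverse = letters T := by
  ext c
  simp only [mem_letters, List.mem_reverse]

lemma mem_letters_cons {c : α} {p : α × α} {T : Word α} :
    c ∈ letters (p :: T) ↔ (c = p.1 ∨ c = p.2) ∨ c ∈ letters T := by
  simp only [mem_letters, List.mem_cons, or_and_right, exists_or, exists_eq_left]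

lemma card_letters_le (T : Word α) : (letters T).card ≤ T.length * 2 :=
  (Finset.card_biUnion_le_card_mul _ _ _ fun _ _ => Finset.card_le_two).trans
    (Nat.mul_le_mul_right 2 T.toFinset_card_le)

lemma exists_mapWord_eq {α : Type*} {g : α → β} {T : Word β}
    (hT : ∀ c ∈ letters T, c ∈ Set.range g) : ∃ V, mapWord g V = T := by
  have : T ∈ Set.range (List.map (Prod.map g g)) := by
    rw [Set.range_list_map, Set.range_prodMap]
    exact fun p hp => ⟨hT _ (mem_letters.2 ⟨p, hp, Or.inl rfl⟩),
      hT _ (mem_letters.2 ⟨p, hp, Or.inr rfl⟩)⟩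
  exact this

lemma exists_mapWord_orderEmbOfFin_eq {T : Word α} {L : Finset α} (hT : letters T = L) :
    ∃ V, letters V = Finset.univ ∧ mapWord (L.orderEmbOfFin rfl) V = T := by
  obtain ⟨V, hV⟩ := exists_mapWord_eq (g := L.orderEmbOfFin rfl) (T := T) fun c hc => by
    rwa [Finset.range_orderEmbOfFin, Finset.mem_coe, ← hT]
  refine ⟨V, Finset.image_injective (L.orderEmbOfFin rfl).injective ?_, hV⟩
  rw [← letters_mapWord, hV, hT, Finset.image_orderEmbOfFin_univ]

lemma isCyclicEmbedding_orderEmbedding (f : α ↪o β) : IsCyclicEmbedding f :=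
  isCyclicEmbedding_of_strictMono f.strictMono

lemma admissible_neg_or_nonneg {T : Word α} {e : α} (he : e ∈ letters T) :
    (∀ F, Admissible F T → F e < 0) ∨ ∀ F, Admissible F T → 0 ≤ F e := by
  induction T with
  | nil => simp [letters] at he
  | cons p T ih =>
    by_cases hfst : e = p.1
    · exact Or.inl fun F hF => hfst ▸ hF.1.1
    by_cases hsnd : e = p.2
    · exact Or.inr fun F hF => hsnd ▸ hF.1.2.1
    have hfix (F : α → ℤ) : (F ∘ swap p.1 p.2) e = F e := by
      rw [Function.comp_apply, swap_apply_of_ne_of_ne hfst hsnd]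
    have hT := (mem_letters_cons.1 he).resolve_left (not_or.2 ⟨hfst, hsnd⟩)
    exact (ih hT).imp (fun h F hF => hfix F ▸ h _ hF.2) fun h F hF => hfix F ▸ h _ hF.2

lemma Admissible.update {T : Word α} {e : α} (he : e ∉ letters T) {F : α → ℤ} {x : ℤ}
    (hx : (∀ c, x < F c) ∨ ∀ c, F c < x) (h : Admissible F T) :
    Admissible (Function.update F e x) T := by
  induction T generalizing F with
  | nil => trivial
  | cons p T ih =>
    rw [mem_letters_cons, not_or, not_or] at he
    obtain ⟨⟨hfst, hsnd⟩, hT⟩ := he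
    obtain ⟨⟨hleft, hright, hbetween⟩, htail⟩ := h
    refine ⟨?_, ?_⟩
    · rw [CanApply, Function.update_of_ne (Ne.symm hfst), Function.update_of_ne (Ne.symm hsnd)]
      refine ⟨hleft, hright, fun c hc => ?_⟩
      rcases eq_or_ne c e with rfl | hce
      · rw [Function.update_self]
        exact hx.imp (· _) (· _)
      · rw [Function.update_of_ne hce]
        exact hbetween c hc
    · rw [Function.update_comp_equiv, symm_swap, swap_apply_of_ne_of_ne hfst hsnd]
      exact ih hT (hx.imp (fun h c => h _) fun h c => h _) htail

end UnionOfLetters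

section Equivalences

variable {n : ℕ}

lemma letters_subset_of_equivalent {S T : Word (Fin n)} (h : Equivalent (word S) (word T))
    (hS : S ≠ []) {F : Fin n → ℤ} (hF : Function.Injective F) (hadm : Admissible F S) :
    letters T ⊆ letters S := by
  intro e heT
  by_contra heS
  have hupdate {x : ℤ} (hx : (∀ c, x < F c) ∨ ∀ c, F c < x) :
      Admissible (Function.update F e x) T := by
    refine (admissible_and_sameEffect_of_equivalent h hS ?_ (hadm.update heS hx)).1
    have hne (c : Fin n) : F c ≠ x := hx.elim (fun h => (h c).ne') fun h => (h c).ne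
    intro c d hcd
    simp only [Function.update_apply] at hcd
    grind [hF.eq_iff]
  obtain ⟨lower, hlower⟩ := (Set.finite_range F).bddBelow
  obtain ⟨upper, hupper⟩ := (Set.finite_range F).bddAbove
  have hbelow := hupdate (x := min lower 0 - 1)
    (Or.inl fun c => by have := hlower ⟨c, rfl⟩; omega)
  have habove := hupdate (x := max upper 0 + 1)
    (Or.inr fun c => by have := hupper ⟨c, rfl⟩; omega)
  rcases admissible_neg_or_nonneg heT with hneg | hnonneg
  · have := hneg _ habove
    rw [Function.update_self] at this
    omega
  · have := hnonneg _ hbelow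
    rw [Function.update_self] at this
    omega

lemma letters_eq_of_equivalent {S T : Word (Fin n)} (h : Equivalent (word S) (word T))
    (hS : S ≠ []) (hT : T ≠ []) {F : Fin n → ℤ} (hF : Function.Injective F)
    (hadm : Admissible F S) : letters S = letters T :=
  (letters_subset_of_equivalent h.symm hT hF
    (admissible_and_sameEffect_of_equivalent h hS hF hadm).1).antisymm
    (letters_subset_of_equivalent h hS hF hadm)

lemma exists_admissible_mapWord {m : ℕ} {g : Fin m → Fin n} (hg : IsCyclicEmbedding g)
    {F : Fin m → ℤ} (hF : Function.Injective F) {T : Word (Fin m)} (h : Admissible F T) :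
    ∃ G : Fin n → ℤ, Function.Injective G ∧ Admissible G (mapWord g T) := by
  obtain ⟨G, hG, rfl, houtside⟩ := exists_extension hg.injective hF
  exact ⟨G, hG, h.mapWord hg houtside⟩

lemma exists_braidEquiv_of_equivalent_zero_of_mapWord {m : ℕ} [NeZero m] (hm : m ≤ 8)
    {g : Fin m → Fin n} (hg : IsCyclicEmbedding g) {V : Word (Fin m)}
    (hletters : letters V = Finset.univ) (hlen : V.length = 4)
    (h : Equivalent (word (mapWord g V)) 0) :
    ∃ X, BraidEquiv (mapWord g V) X ∧ (HasZeroFactor X ∨ IsExceptionalZero X) := by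
  rcases admissible_or_braidEquiv_of_letters_eq_univ hm hletters hlen with
    ⟨F, hF, hadm⟩ | ⟨X, hVX, hX⟩
  · obtain ⟨G, hG, hadm⟩ := exists_admissible_mapWord hg hF hadm
    have hne : mapWord g V ≠ [] := List.ne_nil_of_length_eq_add_one ((List.length_map _).trans hlen)
    exact absurd h (not_equivalent_zero hne hG hadm)
  · exact ⟨_, hVX.mapWord hg,
      hX.imp (HasZeroFactor.mapWord hg) (isExceptionalZero_mapWord_iff hg).2⟩

lemma exists_braidEquiv_of_sameEffect_of_mapWord {m : ℕ} [NeZero m] (hm : m ≤ 8)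
    {g : Fin m → Fin n} (hg : IsCyclicEmbedding g) {U V : Word (Fin m)}
    (hU : letters U = Finset.univ) (hV : letters V = Finset.univ)
    (hlenU : U.length = 4) (hlenV : V.length = 4)
    (h : SameEffect (mapWord g U) (mapWord g V)) :
    ∃ X Y, BraidEquiv (mapWord g U) X ∧ BraidEquiv (mapWord g V) Y ∧
      (HasZeroFactor X ∨ HasZeroFactor Y ∨ X = Y ∨ IsExceptionalPair X Y) := by
  obtain ⟨X, Y, hUX, hVY, hXY⟩ :=
    braidEquiv_of_sameEffect_of_letters_eq_univ hm hU hV hlenU hlenV (.of_mapWord hg h)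
  exact ⟨_, _, hUX.mapWord hg, hVY.mapWord hg, hXY.imp (HasZeroFactor.mapWord hg)
    (.imp (HasZeroFactor.mapWord hg) (.imp (congrArg _) (isExceptionalPair_mapWord_iff hg).2))⟩

lemma card_letters_neZero {T : Word (Fin n)} (hT : T ≠ []) : NeZero (letters T).card := by
  obtain ⟨p, hp⟩ := List.exists_mem_of_ne_nil T hT
  exact ⟨Finset.card_ne_zero_of_mem (mem_letters.2 ⟨p, hp, Or.inl rfl⟩)⟩

theorem exists_braidEquiv_of_equivalent_zero {T : Word (Fin n)} (hlen : T.length = 4)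
    (h : Equivalent (word T) 0) :
    ∃ X, BraidEquiv T X ∧ (HasZeroFactor X ∨ IsExceptionalZero X) := by
  have := card_letters_neZero (List.ne_nil_of_length_eq_add_one hlen)
  have hcard : (letters T).card ≤ 8 := (card_letters_le T).trans_eq (by rw [hlen])
  obtain ⟨L, hL⟩ : ∃ L, letters T = L := ⟨_, rfl⟩
  rw [hL] at this hcard
  obtain ⟨V, hV, rfl⟩ := exists_mapWord_orderEmbOfFin_eq hL
  exact exists_braidEquiv_of_equivalent_zero_of_mapWord hcard
    (isCyclicEmbedding_orderEmbedding _) hV ((List.length_map _).symm.trans hlen) h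

lemma not_hasZeroFactor_of_braidEquiv {T X : Word (Fin n)} (h : ¬ Equivalent (word T) 0)
    (hTX : BraidEquiv T X) : ¬ HasZeroFactor X :=
  fun hX => h (hTX.wordEquiv.equivalent.trans hX.vanishes.equivalent)

theorem exists_braidEquiv_of_equivalent {S T : Word (Fin n)} (hlenS : S.length = 4)
    (hlenT : T.length = 4) (h : Equivalent (word S) (word T)) (h0 : ¬ Equivalent (word S) 0) :
    ∃ X Y, BraidEquiv S X ∧ BraidEquiv T Y ∧ (X = Y ∨ IsExceptionalPair X Y) := by
  have hS := List.ne_nil_of_length_eq_add_one hlenS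
  have := card_letters_neZero hS
  have hcard : (letters S).card ≤ 8 := (card_letters_le S).trans_eq (by rw [hlenS])
  obtain ⟨F, hF, hadm⟩ := exists_admissible_of_not_equivalent_zero h0
  have heffect := (admissible_and_sameEffect_of_equivalent h hS hF hadm).2
  obtain ⟨L, hL⟩ : ∃ L, letters S = L := ⟨_, rfl⟩
  have hLT : letters T = L := by
    rw [← hL, letters_eq_of_equivalent h hS (List.ne_nil_of_length_eq_add_one hlenT) hF hadm]
  rw [hL] at this hcard
  have h0' : ¬ Equivalent (word T) 0 := fun hT => h0 (h.trans hT)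
  obtain ⟨U, hU, rfl⟩ := exists_mapWord_orderEmbOfFin_eq hL
  obtain ⟨V, hV, rfl⟩ := exists_mapWord_orderEmbOfFin_eq hLT
  obtain ⟨X, Y, hX, hY, hXY⟩ := exists_braidEquiv_of_sameEffect_of_mapWord hcard
    (isCyclicEmbedding_orderEmbedding _) hU hV ((List.length_map _).symm.trans hlenS)
    ((List.length_map _).symm.trans hlenT) heffect
  exact ⟨X, Y, hX, hY, (hXY.resolve_left (not_hasZeroFactor_of_braidEquiv h0 hX)).resolve_left
    (not_hasZeroFactor_of_braidEquiv h0' hY)⟩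

end Equivalences

section Rigidity

variable {α β : Type*} [LinearOrder α] [LinearOrder β] {g : α → β}

/-- On some permutation the word acts as no other word of the same degree in the same letters
does. -/
def IsRigid (T : Word α) : Prop :=
  ∃ F : α → ℤ, Function.Injective F ∧ Admissible F T ∧ ∀ S, letters S ⊆ letters T →
    S.length = T.length → Admissible F S → SameEffect S T → S = T

lemma IsRigid.mapWord [Finite α] [Countable β] (hg : IsCyclicEmbedding g) {T : Word α}
    (h : IsRigid T) : IsRigid (mapWord g T) := by
  have := Fintype.ofFinite α
  obtain ⟨F, hF, hadm, hunique⟩ := h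
  obtain ⟨G, hG, rfl, houtside⟩ := exists_extension (β := β) hg.injective hF
  refine ⟨G, hG, hadm.mapWord hg houtside, fun S' hletters hlen hadm' heffect => ?_⟩
  rw [letters_mapWord] at hletters
  obtain ⟨S, rfl⟩ := exists_mapWord_eq fun c hc => by
    obtain ⟨x, -, hx⟩ := Finset.mem_image.1 (hletters hc)
    exact ⟨x, hx⟩
  rw [letters_mapWord, Finset.image_subset_image_iff hg.injective] at hletters
  rw [hunique S hletters (by simpa only [QuantumBruhat.mapWord, List.length_map] using hlen)
    (.of_mapWord hg hadm') (.of_mapWord hg heffect)]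

lemma IsRigid.reverse {T : Word α} (h : IsRigid T) : IsRigid T.reverse := by
  obtain ⟨F, hF, hadm, hunique⟩ := h
  refine ⟨fun c => -1 - F ((permOf T)⁻¹ c),
    fun c d hcd => (permOf T)⁻¹.injective (hF (by simpa using hcd)), ?_, ?_⟩
  · rw [admissible_reverse]
    simpa using hadm
  · intro S hletters hlen hadmS heffect
    rw [← List.reverse_eq_iff]
    have hperm : permOf S = (permOf T)⁻¹ := by rw [heffect.1, permOf_reverse]
    refine hunique _ ?_ (by simpa using hlen) ?_ (by simpa using heffect.reverse)
    · rwa [letters_reverse, ← letters_reverse T]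
    · rwa [admissible_reverse, hperm]

end Rigidity

section RigidityCheck

variable {m : ℕ}

/-- The words of length `k` that are admissible for `F`. -/
def admissibleWords (m : ℕ) : ℕ → (Fin m → ℤ) → List (Word (Fin m))
  | 0, _ => [[]]
  | k + 1, F => ((operators m).filter (CanApply F ·)).flatMap fun p =>
      (admissibleWords m k (F ∘ swap p.1 p.2)).map (p :: ·)

lemma mem_admissibleWords {F : Fin m → ℤ} {T : Word (Fin m)} (h : Admissible F T) :
    T ∈ admissibleWords m T.length F := by
  induction T generalizing F with
  | nil => exact List.mem_singleton_self []
  | cons p T ih =>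
    refine List.mem_flatMap.2 ⟨p, List.mem_filter.2 ⟨mem_operators.2 fun hp => ?_,
      decide_eq_true h.1⟩, List.mem_map.2 ⟨T, ih h.2, rfl⟩⟩
    exact (hp ▸ h.1.1).not_ge h.1.2.1

/-- A test for `IsRigid` that evaluates quickly. -/
def PassesRigidityTest (T : Word (Fin m)) : Prop :=
  Admissible (testPlaces T) T ∧ ∀ S ∈ admissibleWords m T.length (testPlaces T),
    permCode S = permCode T → wsum powerWeight S = wsum powerWeight T → S = T

instance (T : Word (Fin m)) : Decidable (PassesRigidityTest T) :=
  inferInstanceAs (Decidable (_ ∧ _))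

lemma PassesRigidityTest.isRigid {T : Word (Fin m)} (h : PassesRigidityTest T) : IsRigid T :=
  ⟨testPlaces T, testPlaces_injective T, h.1, fun S _ hlen hadm heffect =>
    h.2 S (hlen ▸ mem_admissibleWords hadm) (by rw [permCode, heffect.1, permCode]) (heffect.2 _)⟩

end RigidityCheck

section RigidFactors

variable {α : Type*} [LinearOrder α]

/-- The words for which neither the last nor the first `d - 1` of the `d` operators can be replaced
by another word. -/
def HasRigidFactors (T : Word α) : Prop := IsRigid T.tail ∧ IsRigid T.dropLast

lemma HasRigidFactors.mapWord {β : Type*} [LinearOrder β] [Finite α] [Countable β] {g : α → β}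
    (hg : IsCyclicEmbedding g) {T : Word α} (h : HasRigidFactors T) :
    HasRigidFactors (mapWord g T) := by
  rw [HasRigidFactors, QuantumBruhat.mapWord, ← List.map_tail, ← List.map_dropLast]
  exact ⟨h.1.mapWord hg, h.2.mapWord hg⟩

lemma HasRigidFactors.reverse {T : Word α} (h : HasRigidFactors T) : HasRigidFactors T.reverse := by
  rw [HasRigidFactors, List.tail_reverse, List.dropLast_reverse]
  exact ⟨h.2.reverse, h.1.reverse⟩

end RigidFactors

section Minimality

variable {n : ℕ}

lemma Equivalent.mul {u u' v v' : WithZero (Comp n)} (hu : Equivalent u u')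
    (hv : Equivalent v v') : Equivalent (u * v) (u' * v') := fun k hk hkn x => by
  rw [act_mul, act_mul, ← hv k hk hkn]
  cases act k v (some x) with
  | none => rw [act_none, act_none]
  | some y => exact hu k hk hkn y

lemma IsRigid.word_ne_zero {T : Word (Fin n)} (h : IsRigid T) (hT : T ≠ []) : word T ≠ 0 := by
  obtain ⟨F, hF, hadm, -⟩ := h
  exact fun h0 => not_equivalent_zero hT hF hadm (h0 ▸ Equivalent.refl _)

lemma IsRigid.eq_word_of_equivalent {T : Word (Fin n)} (h : IsRigid T) (hT : T ≠ [])
    {z : WithZero (Comp n)} (hz : Equivalent (word T) z) : z = word T := by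
  obtain ⟨F, hF, hadm, hunique⟩ := h
  cases z with
  | zero => exact absurd hz (not_equivalent_zero hT hF hadm)
  | coe v =>
    rw [← word_opList] at hz ⊢
    have hlen := length_eq_of_equivalent hz hT hF hadm
    have hv : opList v ≠ [] := by
      rwa [← List.length_pos_iff, ← hlen, List.length_pos_iff]
    obtain ⟨hadm', heffect⟩ := admissible_and_sameEffect_of_equivalent hz hT hF hadm
    rw [hunique _ (letters_eq_of_equivalent hz hT hv hF hadm).ge hlen.symm hadm' heffect.symm]

lemma append_append_eq_cases {X S Y D : Word (Fin n)} (h : Y ++ S ++ X = D)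
    (hS : S.length < D.length) : (∃ p Y', Y = p :: Y' ∧ Y' ++ S ++ X = D.tail) ∨
      ∃ p X', X = X' ++ [p] ∧ Y ++ S ++ X' = D.dropLast := by
  subst h
  cases Y with
  | cons p Y => exact Or.inl ⟨p, Y, rfl, rfl⟩
  | nil =>
    rcases List.eq_nil_or_concat X with rfl | ⟨X, p, rfl⟩
    · simp at hS
    · refine Or.inr ⟨p, X, List.concat_eq_append, ?_⟩
      rw [List.concat_eq_append, ← List.append_assoc, List.dropLast_concat]

/-- The congruence that relates `u` and `v` if they can replace each other in factorizations
of `z`. -/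
def factorCon (z : WithZero (Comp n)) : Con (WithZero (Comp n)) where
  r u v := ∀ x y, x * u * y = z ↔ x * v * y = z
  iseqv := ⟨fun _ _ _ => Iff.rfl, fun h x y => (h x y).symm, fun h h' x y => (h x y).trans (h' x y)⟩
  mul' {u v u' v'} h h' x y := by
    rw [← mul_assoc, mul_assoc (x * u), h x, ← mul_assoc, h', mul_assoc x]

lemma exists_word_eq {z : WithZero (Comp n)} (hz : z ≠ 0) : ∃ T, word T = z := by
  obtain ⟨v, rfl⟩ := WithZero.ne_zero_iff_exists.1 hz
  exact ⟨opList v, word_opList v⟩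

lemma word_injOn {S T : Word (Fin n)} (hT : word T ≠ 0) (h : word S = word T) : S = T := by
  obtain ⟨v, hv⟩ := WithZero.ne_zero_iff_exists.1 hT
  rw [← opList_eq_of_word_eq hv.symm, ← opList_eq_of_word_eq (h.trans hv.symm)]

lemma HasRigidFactors.word_ne_zero {D : Word (Fin n)} (hlen : 2 < D.length)
    (h : HasRigidFactors D) : word D ≠ 0 := by
  obtain ⟨p, q, r, T, rfl⟩ : ∃ p q r T, D = p :: q :: r :: T := by
    match D, hlen with
    | p :: q :: r :: T, _ => exact ⟨p, q, r, T, rfl⟩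
  refine mul_ne_zero (h.1.word_ne_zero (List.cons_ne_nil _ _)) ?_
  exact right_ne_zero_of_mul (h.2.word_ne_zero (List.cons_ne_nil _ _))

lemma HasRigidFactors.mul_mul_eq_of_equivalent {D : Word (Fin n)} (hlen : 2 < D.length)
    (h : HasRigidFactors D) {u v x y : WithZero (Comp n)} (huv : Equivalent u v)
    (hu : DegreeLT D.length u) (hxy : x * u * y = word D) : x * v * y = word D := by
  have h0 : x * u * y ≠ 0 := hxy ▸ h.word_ne_zero hlen
  obtain ⟨X, rfl⟩ := exists_word_eq (left_ne_zero_of_mul (left_ne_zero_of_mul h0))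
  obtain ⟨U, rfl⟩ := exists_word_eq (right_ne_zero_of_mul (left_ne_zero_of_mul h0))
  obtain ⟨Y, rfl⟩ := exists_word_eq (right_ne_zero_of_mul h0)
  have hD : Y ++ U ++ X = D := by
    refine word_injOn (h.word_ne_zero hlen) ?_
    rw [word_append, word_append, ← mul_assoc, hxy]
  have hU : U.length < D.length := by
    obtain ⟨w, hw⟩ := WithZero.ne_zero_iff_exists.1 (right_ne_zero_of_mul (left_ne_zero_of_mul h0))
    rw [← opList_eq_of_word_eq hw.symm, length_opList]
    exact hu w hw.symm
  have replace {A B E : Word (Fin n)} (hE : IsRigid E) (hne : E ≠ []) (hAB : A ++ U ++ B = E) :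
      word B * v * word A = word E := by
    refine hE.eq_word_of_equivalent hne ?_
    rw [← hAB, word_append, word_append, ← mul_assoc]
    exact ((Equivalent.refl _).mul huv).mul (.refl _)
  rcases append_append_eq_cases hD hU with ⟨p, Y, rfl, htail⟩ | ⟨p, X, rfl, hinit⟩
  · have hne : D.tail ≠ [] := by rw [← List.length_pos_iff, List.length_tail]; omega
    rw [word, ← mul_assoc, replace h.1 hne htail, ← htail]
    exact congrArg word hD
  · have hne : D.dropLast ≠ [] := by rw [← List.length_pos_iff, List.length_dropLast]; omega
    rw [word_append, mul_assoc, mul_assoc, ← mul_assoc (word X), replace h.2 hne hinit, ← hinit,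
      ← word_append, List.append_assoc, ← hD]

theorem HasRigidFactors.eq_word_of_isConsequence {D : Word (Fin n)} (hlen : 2 < D.length)
    (h : HasRigidFactors D) {z : WithZero (Comp n)} (hz : IsConsequence D.length (word D) z) :
    z = word D := by
  have hle : conGen (LowerEquivalence D.length) ≤ factorCon (word D) := Con.conGen_le.2
    fun u v huv x y => ⟨h.mul_mul_eq_of_equivalent hlen huv.1 huv.2.1,
      h.mul_mul_eq_of_equivalent hlen huv.1.symm huv.2.2⟩
  simpa using hle hz 1 1

end Minimality

section ExceptionalWords

/-- The standard representative of `IsCascade`. -/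
def cascade : Word (Fin 5) := [(3, 0), (0, 1), (1, 2), (2, 4)]

/-- The standard representative of the left-hand side of `IsQuartic`. -/
def quarticLeft : Word (Fin 4) := [(3, 0), (0, 1), (1, 2), (2, 0)]

/-- The standard representative of the right-hand side of `IsQuartic`. -/
def quarticRight : Word (Fin 4) := [(3, 1), (1, 2), (2, 3), (3, 0)]

lemma hasRigidFactors_cascade : HasRigidFactors cascade :=
  ⟨PassesRigidityTest.isRigid (by decide +kernel), PassesRigidityTest.isRigid (by decide +kernel)⟩

lemma hasRigidFactors_quarticLeft : HasRigidFactors quarticLeft :=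
  ⟨PassesRigidityTest.isRigid (by decide +kernel), PassesRigidityTest.isRigid (by decide +kernel)⟩

lemma hasRigidFactors_quarticRight : HasRigidFactors quarticRight :=
  ⟨PassesRigidityTest.isRigid (by decide +kernel), PassesRigidityTest.isRigid (by decide +kernel)⟩

variable {α : Type*} [LinearOrder α]

lemma IsCascade.exists_eq_mapWord {T : Word α} (h : IsCascade T) :
    ∃ (f : Fin 5 ↪o α) (j : Fin 5), T = mapWord f (rotate j cascade) := by
  obtain @⟨a, b, c, d, e, h, h', h''⟩ := h
  have hchain : (a < b ∧ b < c ∧ c < d ∧ d < e) ∨ (b < c ∧ c < d ∧ d < e ∧ e < a) ∨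
      (c < d ∧ d < e ∧ e < a ∧ a < b) ∨ (d < e ∧ e < a ∧ a < b ∧ b < c) ∨
      (e < a ∧ a < b ∧ b < c ∧ c < d) := by grind [Cyc]
  have hmono {a b c d e : α} (h : a < b ∧ b < c ∧ c < d ∧ d < e) : StrictMono ![a, b, c, d, e] := by
    simpa [Fin.strictMono_iff_lt_succ, Fin.forall_fin_succ] using h
  rcases hchain with h | h | h | h | h
  · exact ⟨.ofStrictMono _ (hmono h), 0, rfl⟩
  · exact ⟨.ofStrictMono _ (hmono h), 4, rfl⟩
  · exact ⟨.ofStrictMono _ (hmono h), 3, rfl⟩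
  · exact ⟨.ofStrictMono _ (hmono h), 2, rfl⟩
  · exact ⟨.ofStrictMono _ (hmono h), 1, rfl⟩

lemma IsQuartic.exists_eq_mapWord {S T : Word α} (h : IsQuartic S T) :
    ∃ (f : Fin 4 ↪o α) (j : Fin 4),
      S = mapWord f (rotate j quarticLeft) ∧ T = mapWord f (rotate j quarticRight) := by
  obtain @⟨a, b, c, d, h, h'⟩ := h
  have hchain : (a < b ∧ b < c ∧ c < d) ∨ (b < c ∧ c < d ∧ d < a) ∨
      (c < d ∧ d < a ∧ a < b) ∨ (d < a ∧ a < b ∧ b < c) := by grind [Cyc]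
  have hmono {a b c d : α} (h : a < b ∧ b < c ∧ c < d) : StrictMono ![a, b, c, d] := by
    simpa [Fin.strictMono_iff_lt_succ, Fin.forall_fin_succ] using h
  rcases hchain with h | h | h | h
  · exact ⟨.ofStrictMono _ (hmono h), 0, rfl, rfl⟩
  · exact ⟨.ofStrictMono _ (hmono h), 3, rfl, rfl⟩
  · exact ⟨.ofStrictMono _ (hmono h), 2, rfl, rfl⟩
  · exact ⟨.ofStrictMono _ (hmono h), 1, rfl, rfl⟩

lemma HasRigidFactors.of_eq_mapWord {m : ℕ} [NeZero m] [Countable α] {V : Word (Fin m)}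
    (h : HasRigidFactors V) (f : Fin m ↪o α) (j : Fin m) :
    HasRigidFactors (QuantumBruhat.mapWord f (rotate j V)) :=
  (h.mapWord (isCyclicEmbedding_add_right j)).mapWord (isCyclicEmbedding_orderEmbedding f)

lemma IsCascade.hasRigidFactors [Countable α] {T : Word α} (h : IsCascade T) :
    HasRigidFactors T := by
  obtain ⟨f, j, rfl⟩ := h.exists_eq_mapWord
  exact hasRigidFactors_cascade.of_eq_mapWord f j

lemma IsQuartic.hasRigidFactors [Countable α] {S T : Word α} (h : IsQuartic S T) :
    HasRigidFactors S ∧ HasRigidFactors T := by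
  obtain ⟨f, j, rfl, rfl⟩ := h.exists_eq_mapWord
  exact ⟨hasRigidFactors_quarticLeft.of_eq_mapWord f j,
    hasRigidFactors_quarticRight.of_eq_mapWord f j⟩

lemma IsExceptionalZero.hasRigidFactors [Countable α] {T : Word α} (h : IsExceptionalZero T) :
    HasRigidFactors T :=
  h.elim IsCascade.hasRigidFactors fun h => T.reverse_reverse ▸ h.hasRigidFactors.reverse

lemma IsExceptionalPair.symm {S T : Word α} (h : IsExceptionalPair S T) : IsExceptionalPair T S :=
  h.imp Or.symm Or.symm

lemma IsExceptionalPair.hasRigidFactors [Countable α] {S T : Word α} (h : IsExceptionalPair S T) :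
    HasRigidFactors S := by
  rcases h with (h | h) | h | h
  · exact h.hasRigidFactors.1
  · exact h.hasRigidFactors.2
  · exact S.reverse_reverse ▸ h.hasRigidFactors.1.reverse
  · exact S.reverse_reverse ▸ h.hasRigidFactors.2.reverse

lemma IsExceptionalZero.vanishes {T : Word α} (h : IsExceptionalZero T) : Vanishes T :=
  h.elim IsCascade.vanishes fun h => T.reverse_reverse ▸ h.vanishes.reverse

lemma IsExceptionalPair.wordEquiv {S T : Word α} (h : IsExceptionalPair S T) : WordEquiv S T := by
  rcases h with (h | h) | h | h
  · exact h.wordEquiv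
  · exact h.wordEquiv.symm
  · simpa using h.wordEquiv.reverse
  · simpa using h.wordEquiv.symm.reverse

lemma IsCascade.length_eq {T : Word α} (h : IsCascade T) : T.length = 4 := by
  cases h
  rfl

lemma IsQuartic.length_eq {S T : Word α} (h : IsQuartic S T) : S.length = 4 ∧ T.length = 4 := by
  cases h
  exact ⟨rfl, rfl⟩

lemma IsExceptionalZero.length_eq {T : Word α} (h : IsExceptionalZero T) : T.length = 4 :=
  h.elim IsCascade.length_eq fun h => T.length_reverse.symm.trans h.length_eq

lemma IsExceptionalPair.length_eq {S T : Word α} (h : IsExceptionalPair S T) : S.length = 4 := by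
  rcases h with (h | h) | h | h
  · exact h.length_eq.1
  · exact h.length_eq.2
  · exact S.length_reverse.symm.trans h.length_eq.1
  · exact S.length_reverse.symm.trans h.length_eq.2

lemma IsQuartic.ne {S T : Word α} (h : IsQuartic S T) : S ≠ T := by
  obtain @⟨a, b, c, d, h, h'⟩ := h
  intro heq
  simp only [List.cons.injEq, Prod.mk.injEq] at heq
  grind [Cyc]

lemma IsExceptionalPair.ne {S T : Word α} (h : IsExceptionalPair S T) : S ≠ T := by
  rintro rfl
  rcases h with (h | h) | h | h <;> exact h.ne rfl

end ExceptionalWords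

section Minimal

variable {n : ℕ}

lemma HasRigidFactors.eq_of_isConsequence {S T : Word (Fin n)} (h : HasRigidFactors S)
    (hlen : S.length = 4) (hST : IsConsequence 4 (word S) (word T)) : S = T :=
  (word_injOn (h.word_ne_zero (by omega)) (h.eq_word_of_isConsequence (by omega)
    (by rwa [hlen]))).symm

theorem isMinimalZero_iff {w : Comp n} : IsMinimalZero 4 w ↔ IsExceptionalZero (opList w) := by
  rw [IsMinimalZero, ← length_opList, ← word_opList]
  constructor
  · rintro ⟨hlen, hzero, hmin⟩
    obtain ⟨X, hX, hfactor | hexc⟩ := exists_braidEquiv_of_equivalent_zero hlen hzero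
    · exact absurd ((conGen _).trans hX.isConsequence hfactor.isConsequence) hmin
    · rwa [← hexc.hasRigidFactors.eq_of_isConsequence hexc.length_eq hX.symm.isConsequence]
  · intro h
    refine ⟨h.length_eq, h.vanishes.equivalent, fun hcons => ?_⟩
    have hrigid := h.hasRigidFactors
    have hlen : 2 < (opList w).length := by rw [h.length_eq]; norm_num
    exact hrigid.word_ne_zero hlen
      (hrigid.eq_word_of_isConsequence hlen (by rwa [h.length_eq])).symm

lemma exists_admissible_quarticLeft :
    ∃ F : Fin 4 → ℤ, Function.Injective F ∧ Admissible F quarticLeft :=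
  ⟨testPlaces quarticLeft, testPlaces_injective _, by decide +kernel⟩

lemma IsQuartic.exists_admissible {S T : Word (Fin n)} (h : IsQuartic S T) :
    ∃ F : Fin n → ℤ, Function.Injective F ∧ Admissible F S ∧ Admissible F T := by
  obtain ⟨f, j, hS, -⟩ := h.exists_eq_mapWord
  obtain ⟨F, hF, hadm⟩ := exists_admissible_quarticLeft
  obtain ⟨G, hG, hadm⟩ := exists_admissible_mapWord (isCyclicEmbedding_add_right j) hF hadm
  obtain ⟨H, hH, hadm⟩ := exists_admissible_mapWord (isCyclicEmbedding_orderEmbedding f) hG hadm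
  rw [← rotate, ← hS] at hadm
  exact ⟨H, hH, hadm, (h.wordEquiv.1 H).1 hadm⟩

lemma exists_admissible_of_reverse {F : Fin n → ℤ} (hF : Function.Injective F)
    {T : Word (Fin n)} (h : Admissible F T.reverse) :
    ∃ G : Fin n → ℤ, Function.Injective G ∧ Admissible G T :=
  ⟨_, fun c d hcd => (permOf T).injective (hF (by simpa using hcd)), (admissible_reverse F T).1 h⟩

lemma IsExceptionalPair.exists_admissible {S T : Word (Fin n)} (h : IsExceptionalPair S T) :
    ∃ F : Fin n → ℤ, Function.Injective F ∧ Admissible F S := by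
  rcases h with (h | h) | h | h <;> obtain ⟨F, hF, hleft, hright⟩ := h.exists_admissible
  · exact ⟨F, hF, hleft⟩
  · exact ⟨F, hF, hright⟩
  · exact exists_admissible_of_reverse hF hleft
  · exact exists_admissible_of_reverse hF hright

theorem isMinimalNonzero_iff {u w : Comp n} :
    IsMinimalNonzero 4 u w ↔ IsExceptionalPair (opList u) (opList w) := by
  rw [IsMinimalNonzero, ← length_opList, ← length_opList, ← word_opList, ← word_opList]
  constructor
  · rintro ⟨hlenu, hlenw, hequiv, hnonzero, hmin⟩
    obtain ⟨X, Y, hX, hY, rfl | hexc⟩ :=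
      exists_braidEquiv_of_equivalent hlenu hlenw hequiv hnonzero
    · exact absurd (hX.trans hY.symm).isConsequence hmin
    · rwa [← hexc.hasRigidFactors.eq_of_isConsequence hexc.length_eq hX.symm.isConsequence,
        ← hexc.symm.hasRigidFactors.eq_of_isConsequence hexc.symm.length_eq hY.symm.isConsequence]
  · intro h
    obtain ⟨F, hF, hadm⟩ := h.exists_admissible
    exact ⟨h.length_eq, h.symm.length_eq, h.wordEquiv.equivalent,
      not_equivalent_zero (List.ne_nil_of_length_eq_add_one h.length_eq) hF hadm,
      fun hcons => h.ne (h.hasRigidFactors.eq_of_isConsequence h.length_eq hcons)⟩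

end Minimal

section Patterns

variable {m n : ℕ} {f : Fin m ↪o Fin n} {U V : Word (Fin m)} {u v : Comp n}

/-- The horizontal flip of a word in all letters. -/
def mirror (T : Word (Fin m)) : Word (Fin m) := T.map fun p => (p.2.rev, p.1.rev)

/-- The composition `v` arises from the word `V` in all of the letters `0, …, m - 1` by the
substitution `f`, so that the support of `v` is the range of `f`. -/
def HasPattern (f : Fin m ↪o Fin n) (V : Word (Fin m)) (v : Comp n) : Prop :=
  letters V = Finset.univ ∧ opList v = mapWord f V

lemma exists_eq_orderEmbOfFin (f : Fin m ↪o Fin n) : ∃ (S : Finset (Fin n)) (hS : S.card = m),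
    Finset.univ.image f = S ∧ f = S.orderEmbOfFin hS := by
  have hcard : (Finset.univ.image f).card = m := by
    rw [Finset.card_image_of_injective _ f.injective, Finset.card_univ, Fintype.card_fin]
  exact ⟨_, hcard, rfl, Finset.orderEmbOfFin_unique' hcard fun i =>
    Finset.mem_image_of_mem f (Finset.mem_univ i)⟩

lemma le_of_orderEmbedding (f : Fin m ↪o Fin n) : m ≤ n :=
  Fin.nonempty_embedding_iff.1 ⟨f.toEmbedding⟩

lemma flattenPerm_apply (f : Fin m ↪o Fin n) (i : Fin m) :
    flattenPerm (Finset.univ.image f) (f i) = Fin.castLE (le_of_orderEmbedding f) i := by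
  obtain ⟨S, rfl, hS, hf⟩ := exists_eq_orderEmbOfFin f
  have hsymm : (finSumEquivOfFinset (s := S) rfl rfl).symm (S.orderEmbOfFin rfl i) = Sum.inl i := by
    rw [symm_apply_eq, finSumEquivOfFinset_inl]
  rw [hS, hf, flattenPerm, trans_apply, hsymm, trans_apply, finSumFinEquiv_apply_left]
  rfl

lemma shiftPerm_apply (f : Fin m ↪o Fin n) (i : Fin m) :
    shiftPerm (Finset.univ.image f) (f i) = f (finRotate m i) := by
  obtain ⟨S, rfl, hS, hf⟩ := exists_eq_orderEmbOfFin f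
  rw [hS, hf]
  exact Perm.extendDomain_apply_image (finRotate S.card) (S.orderIsoOfFin rfl).toEquiv i

lemma flipPerm_apply (f : Fin m ↪o Fin n) (i : Fin m) :
    flipPerm (Finset.univ.image f) (f i) = f i.rev := by
  obtain ⟨S, rfl, hS, hf⟩ := exists_eq_orderEmbOfFin f
  rw [hS, hf]
  exact Perm.extendDomain_apply_image Fin.revPerm (S.orderIsoOfFin rfl).toEquiv i

lemma supp_eq_letters (v : Comp n) : supp v = letters (opList v) := by
  ext c
  simp [supp, mem_letters, opList]

lemma opList_map_relabel (σ : Perm (Fin n)) (v : Comp n) :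
    opList (FreeMonoid.map (relabel σ) v) = mapWord σ (opList v) := by
  simp only [opList, mapWord, FreeMonoid.toList_map, List.map_map, List.map_reverse]
  rfl

lemma opList_map_relabelSwap (σ : Perm (Fin n)) (v : Comp n) :
    opList (FreeMonoid.map (relabelSwap σ) v) = (opList v).map fun p => (σ p.2, σ p.1) := by
  simp only [opList, FreeMonoid.toList_map, List.map_map, List.map_reverse]
  rfl

lemma opList_verticalFlip (v : Comp n) : opList (verticalFlip v) = (opList v).reverse := by
  change (v.toList.reverse.map Subtype.val).reverse = _
  rw [List.map_reverse]
  rfl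

lemma HasPattern.supp_eq (h : HasPattern f V v) : supp v = Finset.univ.image f := by
  rw [supp_eq_letters, h.2, letters_mapWord, h.1]

lemma HasPattern.unique (hu : HasPattern f V u) (hv : HasPattern f V v) : u = v :=
  opList_injective (hu.2.trans hv.2.symm)

lemma exists_hasPattern {L : Finset (Fin n)} (hv : supp v = L) :
    ∃ V, HasPattern (L.orderEmbOfFin rfl) V v := by
  obtain ⟨V, hV, hmap⟩ := exists_mapWord_orderEmbOfFin_eq ((supp_eq_letters v).symm.trans hv)
  exact ⟨V, hV, hmap.symm⟩

lemma mirror_mirror (T : Word (Fin m)) : mirror (mirror T) = T := by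
  simp [mirror, Function.comp_def]

lemma mirror_reverse (T : Word (Fin m)) : mirror T.reverse = (mirror T).reverse :=
  List.map_reverse

lemma letters_mirror (T : Word (Fin m)) :
    letters (mirror T) = (letters T).image Fin.rev := by
  ext c
  simp only [mem_letters, mirror, List.mem_map, Finset.mem_image]
  grind

lemma hasPattern_flatten (h : HasPattern f V v) :
    HasPattern (Fin.castLEOrderEmb (le_of_orderEmbedding f)) V (flatten v) := by
  refine ⟨h.1, ?_⟩
  rw [flatten, opList_map_relabel, h.supp_eq, h.2, mapWord_mapWord]
  exact congrArg (mapWord · V) (funext (flattenPerm_apply f))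

lemma hasPattern_cyclicShift (h : HasPattern f V v) :
    HasPattern f (mapWord (finRotate m) V) (cyclicShift v) := by
  refine ⟨by rw [letters_mapWord, h.1, Finset.image_univ_equiv], ?_⟩
  rw [cyclicShift, opList_map_relabel, h.supp_eq, h.2, mapWord_mapWord, mapWord_mapWord]
  exact congrArg (mapWord · V) (funext (shiftPerm_apply f))

lemma hasPattern_horizontalFlip (h : HasPattern f V v) :
    HasPattern f (mirror V) (horizontalFlip v) := by
  refine ⟨by rw [letters_mirror, h.1]; exact Finset.image_univ_equiv Fin.revPerm, ?_⟩
  rw [horizontalFlip, opList_map_relabelSwap, h.supp_eq, h.2, mirror, mapWord, mapWord,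
    List.map_map, List.map_map]
  exact List.map_congr_left fun p _ => Prod.ext (flipPerm_apply f p.2) (flipPerm_apply f p.1)

lemma hasPattern_verticalFlip (h : HasPattern f V v) :
    HasPattern f V.reverse (verticalFlip v) :=
  ⟨(letters_reverse V).trans h.1, by rw [opList_verticalFlip, h.2, mapWord_reverse]⟩

end Patterns

section Invariance

variable {m n : ℕ}

lemma cyc_rev_iff {a b c : Fin m} : Cyc c.rev b.rev a.rev ↔ Cyc a b c := by
  simp only [Cyc, Fin.rev_lt_rev]
  tauto

lemma IsCascade.reverse_mirror {T : Word (Fin m)} (h : IsCascade T) :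
    IsCascade (mirror T).reverse := by
  obtain @⟨a, b, c, d, e, h, h', h''⟩ := h
  refine .mk (a := c.rev) (b := b.rev) (c := a.rev) (d := e.rev) (e := d.rev) ?_ ?_ ?_ <;>
    rw [cyc_rev_iff] <;> grind [Cyc]

lemma IsQuartic.reverse_mirror {S T : Word (Fin m)} (h : IsQuartic S T) :
    IsQuartic (mirror T).reverse (mirror S).reverse := by
  obtain @⟨a, b, c, d, h, h'⟩ := h
  refine .mk (a := d.rev) (b := c.rev) (c := b.rev) (d := a.rev) ?_ ?_ <;>
    rw [cyc_rev_iff] <;> grind [Cyc]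

lemma isCascade_mirror_iff {T : Word (Fin m)} :
    IsCascade (mirror T) ↔ IsCascade T.reverse :=
  ⟨fun h => by simpa [mirror_mirror] using h.reverse_mirror,
    fun h => by simpa [mirror_reverse] using h.reverse_mirror⟩

lemma isQuartic_mirror_iff {S T : Word (Fin m)} :
    IsQuartic (mirror S) (mirror T) ↔ IsQuartic T.reverse S.reverse :=
  ⟨fun h => by simpa [mirror_mirror] using h.reverse_mirror,
    fun h => by simpa [mirror_reverse] using h.reverse_mirror⟩

lemma isExceptionalZero_mirror_iff {T : Word (Fin m)} :
    IsExceptionalZero (mirror T) ↔ IsExceptionalZero T := by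
  rw [IsExceptionalZero, ← mirror_reverse, isCascade_mirror_iff, isCascade_mirror_iff,
    List.reverse_reverse, or_comm, IsExceptionalZero]

lemma isExceptionalPair_mirror_iff {S T : Word (Fin m)} :
    IsExceptionalPair (mirror S) (mirror T) ↔ IsExceptionalPair S T := by
  simp only [IsExceptionalPair, ← mirror_reverse, isQuartic_mirror_iff, List.reverse_reverse]
  tauto

lemma isExceptionalZero_reverse_iff {T : Word (Fin m)} :
    IsExceptionalZero T.reverse ↔ IsExceptionalZero T := by
  rw [IsExceptionalZero, List.reverse_reverse, or_comm, IsExceptionalZero]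

lemma isExceptionalPair_reverse_iff {S T : Word (Fin m)} :
    IsExceptionalPair S.reverse T.reverse ↔ IsExceptionalPair S T := by
  rw [IsExceptionalPair, List.reverse_reverse, List.reverse_reverse, or_comm, IsExceptionalPair]

lemma isCyclicEmbedding_finRotate (m : ℕ) : IsCyclicEmbedding (finRotate m) := by
  cases m with
  | zero => exact isCyclicEmbedding_of_strictMono fun i => i.elim0
  | succ m =>
    have h := isCyclicEmbedding_add_right (1 : Fin (m + 1))
    rwa [← funext finRotate_apply] at h

lemma HasPattern.isExceptionalZero_iff {f : Fin m ↪o Fin n} {V : Word (Fin m)} {v : Comp n}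
    (h : HasPattern f V v) : IsExceptionalZero (opList v) ↔ IsExceptionalZero V := by
  rw [h.2, isExceptionalZero_mapWord_iff (isCyclicEmbedding_orderEmbedding f)]

lemma HasPattern.isExceptionalPair_iff {f : Fin m ↪o Fin n} {U V : Word (Fin m)} {u v : Comp n}
    (hu : HasPattern f U u) (hv : HasPattern f V v) :
    IsExceptionalPair (opList u) (opList v) ↔ IsExceptionalPair U V := by
  rw [hu.2, hv.2, isExceptionalPair_mapWord_iff (isCyclicEmbedding_orderEmbedding f)]

lemma isExceptionalZero_transformation_iff {T : Comp n → Comp n} (hT : IsTransformation T)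
    (v : Comp n) : IsExceptionalZero (opList (T v)) ↔ IsExceptionalZero (opList v) := by
  obtain ⟨V, h⟩ := exists_hasPattern (rfl : supp v = _)
  rw [h.isExceptionalZero_iff]
  cases hT with
  | flatten => rw [(hasPattern_flatten h).isExceptionalZero_iff]
  | cyclicShift =>
    rw [(hasPattern_cyclicShift h).isExceptionalZero_iff,
      isExceptionalZero_mapWord_iff (isCyclicEmbedding_finRotate _)]
  | horizontalFlip =>
    rw [(hasPattern_horizontalFlip h).isExceptionalZero_iff, isExceptionalZero_mirror_iff]
  | verticalFlip =>
    rw [(hasPattern_verticalFlip h).isExceptionalZero_iff, isExceptionalZero_reverse_iff]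

lemma isExceptionalPair_transformation_iff {T : Comp n → Comp n} (hT : IsTransformation T)
    {u v : Comp n} (huv : supp u = supp v) :
    IsExceptionalPair (opList (T u)) (opList (T v)) ↔
      IsExceptionalPair (opList u) (opList v) := by
  obtain ⟨U, hU⟩ := exists_hasPattern huv
  obtain ⟨V, hV⟩ := exists_hasPattern (rfl : supp v = _)
  rw [hU.isExceptionalPair_iff hV]
  cases hT with
  | flatten =>
    rw [(hasPattern_flatten hU).isExceptionalPair_iff (hasPattern_flatten hV)]
  | cyclicShift =>
    rw [(hasPattern_cyclicShift hU).isExceptionalPair_iff (hasPattern_cyclicShift hV),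
      isExceptionalPair_mapWord_iff (isCyclicEmbedding_finRotate _)]
  | horizontalFlip =>
    rw [(hasPattern_horizontalFlip hU).isExceptionalPair_iff (hasPattern_horizontalFlip hV),
      isExceptionalPair_mirror_iff]
  | verticalFlip =>
    rw [(hasPattern_verticalFlip hU).isExceptionalPair_iff (hasPattern_verticalFlip hV),
      isExceptionalPair_reverse_iff]

lemma Related.isExceptionalZero_iff {v w : Comp n} (h : Related v w) :
    IsExceptionalZero (opList v) ↔ IsExceptionalZero (opList w) := by
  induction h with
  | rel v w h =>
    obtain ⟨T, hT, rfl⟩ := h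
    exact (isExceptionalZero_transformation_iff hT v).symm
  | refl v => rfl
  | symm _ _ _ ih => exact ih.symm
  | trans _ _ _ _ _ ih ih' => exact ih.trans ih'

lemma PairRelated.isExceptionalPair_iff {p q : Comp n × Comp n} (h : PairRelated p q) :
    IsExceptionalPair (opList p.1) (opList p.2) ↔ IsExceptionalPair (opList q.1) (opList q.2) := by
  induction h with
  | rel p q h =>
    obtain ⟨hsupp, T, hT, rfl⟩ := h
    exact (isExceptionalPair_transformation_iff hT hsupp).symm
  | refl p => rfl
  | symm _ _ _ ih => exact ih.symm
  | trans _ _ _ _ _ ih ih' => exact ih.trans ih'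

end Invariance

section Connectedness

variable {m n : ℕ} {f g : Fin m ↪o Fin n} {U V : Word (Fin m)} {u v u' v' : Comp n}

lemma PairRelated.related_fst {p q : Comp n × Comp n} (h : PairRelated p q) :
    Related p.1 q.1 := by
  induction h with
  | rel p q h =>
    obtain ⟨-, T, hT, rfl⟩ := h
    exact .rel _ _ ⟨T, hT, rfl⟩
  | refl p => exact .refl _
  | symm _ _ _ ih => exact ih.symm
  | trans _ _ _ _ _ ih ih' => exact ih.trans _ _ _ ih'

lemma IsTransformation.pairRelated {T : Comp n → Comp n} (hT : IsTransformation T)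
    (huv : supp u = supp v) : PairRelated (u, v) (T u, T v) :=
  .rel _ _ ⟨huv, T, hT, rfl⟩

lemma mapWord_finRotate_rotate [NeZero m] (i : ℕ) (T : Word (Fin m)) :
    mapWord (finRotate m) (rotate (Fin.ofNat m i) T) = rotate (Fin.ofNat m (i + 1)) T := by
  have hrotate : ⇑(finRotate m) = (· + 1) := funext finRotate_apply
  have hsucc : Fin.ofNat m i + 1 = Fin.ofNat m (i + 1) := by
    ext
    simp [Fin.val_add]
  rw [hrotate, ← rotate, rotate_rotate, hsucc]

lemma exists_pairRelated_rotate [NeZero m] (hu : HasPattern f U u) (hv : HasPattern f V v)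
    (j : ℕ) : ∃ u' v', HasPattern f (rotate (Fin.ofNat m j) U) u' ∧
      HasPattern f (rotate (Fin.ofNat m j) V) v' ∧ PairRelated (u, v) (u', v') := by
  induction j with
  | zero => exact ⟨u, v, by rwa [Fin.ofNat_zero, rotate_zero], by rwa [Fin.ofNat_zero, rotate_zero],
      .refl _⟩
  | succ j ih =>
    obtain ⟨u', v', hu', hv', hrel⟩ := ih
    have hshift := IsTransformation.cyclicShift.pairRelated (hu'.supp_eq.trans hv'.supp_eq.symm)
    rw [← mapWord_finRotate_rotate j U, ← mapWord_finRotate_rotate j V]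
    exact ⟨_, _, hasPattern_cyclicShift hu', hasPattern_cyclicShift hv', hrel.trans _ _ _ hshift⟩

lemma pairRelated_of_hasPattern (hu : HasPattern f U u) (hv : HasPattern f V v)
    (hu' : HasPattern g U u') (hv' : HasPattern g V v') : PairRelated (u, v) (u', v') := by
  have h := IsTransformation.flatten.pairRelated (hu.supp_eq.trans hv.supp_eq.symm)
  rw [(hasPattern_flatten hu).unique (hasPattern_flatten hu'),
    (hasPattern_flatten hv).unique (hasPattern_flatten hv')] at h
  exact h.trans _ _ _
    (IsTransformation.flatten.pairRelated (hu'.supp_eq.trans hv'.supp_eq.symm)).symm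

lemma pairRelated_of_hasPattern_rotate [NeZero m] {j : Fin m} (hu : HasPattern f U u)
    (hv : HasPattern f V v) (hu' : HasPattern f (rotate j U) u')
    (hv' : HasPattern f (rotate j V) v') : PairRelated (u, v) (u', v') := by
  obtain ⟨u₁, v₁, hu₁, hv₁, h⟩ := exists_pairRelated_rotate hu hv j
  rw [Fin.ofNat_val_eq_self] at hu₁ hv₁
  rwa [hu₁.unique hu', hv₁.unique hv'] at h

lemma hasPattern_zeroWord (a : Fin 5 ↪o Fin n) : HasPattern a cascade (zeroWord a) :=
  ⟨by decide, rfl⟩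

lemma hasPattern_leftWord (a : Fin 4 ↪o Fin n) : HasPattern a quarticLeft (leftWord a) :=
  ⟨by decide, rfl⟩

lemma hasPattern_rightWord (a : Fin 4 ↪o Fin n) : HasPattern a quarticRight (rightWord a) :=
  ⟨by decide, rfl⟩

theorem related_zeroWord (a b : Fin 5 ↪o Fin n) : Related (zeroWord a) (zeroWord b) :=
  (pairRelated_of_hasPattern (hasPattern_zeroWord a) (hasPattern_zeroWord a)
    (hasPattern_zeroWord b) (hasPattern_zeroWord b)).related_fst

theorem pairRelated_leftWord_rightWord (a b : Fin 4 ↪o Fin n) :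
    PairRelated (leftWord a, rightWord a) (leftWord b, rightWord b) :=
  pairRelated_of_hasPattern (hasPattern_leftWord a) (hasPattern_rightWord a)
    (hasPattern_leftWord b) (hasPattern_rightWord b)

lemma IsCascade.exists_related {w : Comp n} (h : IsCascade (opList w)) :
    ∃ a : Fin 5 ↪o Fin n, Related (zeroWord a) w := by
  obtain ⟨a, j, hw⟩ := h.exists_eq_mapWord
  have hw : HasPattern a (rotate j cascade) w := ⟨letters_rotate (by decide) j, hw⟩
  exact ⟨a, (pairRelated_of_hasPattern_rotate (hasPattern_zeroWord a) (hasPattern_zeroWord a)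
    hw hw).related_fst⟩

lemma IsQuartic.exists_pairRelated (h : IsQuartic (opList u) (opList v)) :
    ∃ a : Fin 4 ↪o Fin n, PairRelated (leftWord a, rightWord a) (u, v) := by
  obtain ⟨a, j, hu, hv⟩ := h.exists_eq_mapWord
  exact ⟨a, pairRelated_of_hasPattern_rotate (hasPattern_leftWord a) (hasPattern_rightWord a)
    ⟨letters_rotate (by decide) j, hu⟩ ⟨letters_rotate (by decide) j, hv⟩⟩

lemma IsQuartic.letters_eq {α : Type*} [LinearOrder α] {S T : Word α} (h : IsQuartic S T) :
    letters S = letters T := by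
  cases h
  ext
  simp only [mem_letters_cons]
  tauto

lemma IsQuartic.supp_eq (h : IsQuartic (opList u) (opList v)) : supp u = supp v := by
  rw [supp_eq_letters, h.letters_eq, supp_eq_letters]

lemma supp_verticalFlip (v : Comp n) : supp (verticalFlip v) = supp v := by
  rw [supp_eq_letters, opList_verticalFlip, letters_reverse, supp_eq_letters]

lemma IsQuartic.exists_pairRelated_swap (h : IsQuartic (opList v) (opList u)) :
    ∃ a : Fin 4 ↪o Fin n, PairRelated (leftWord a, rightWord a) (u, v) := by
  have hsupp := h.supp_eq.symm
  obtain ⟨U, hU⟩ := exists_hasPattern hsupp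
  obtain ⟨V, hV⟩ := exists_hasPattern (rfl : supp v = _)
  -- The half turn composed of the two flips exchanges the two sides.
  have hU' := hasPattern_horizontalFlip hU
  have hV' := hasPattern_horizontalFlip hV
  have hg := isCyclicEmbedding_orderEmbedding ((supp v).orderEmbOfFin rfl)
  rw [hU.2, hV.2, isQuartic_mapWord_iff hg] at h
  have hturn : IsQuartic (opList (verticalFlip (horizontalFlip u)))
      (opList (verticalFlip (horizontalFlip v))) := by
    rw [(hasPattern_verticalFlip hU').2, (hasPattern_verticalFlip hV').2, isQuartic_mapWord_iff hg]
    exact h.reverse_mirror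
  obtain ⟨a, ha⟩ := hturn.exists_pairRelated
  exact ⟨a, ha.trans _ _ _ ((IsTransformation.horizontalFlip.pairRelated hsupp).trans _ _ _
    (IsTransformation.verticalFlip.pairRelated (hU'.supp_eq.trans hV'.supp_eq.symm))).symm⟩

theorem exists_related_zeroWord_iff {w : Comp n} :
    (∃ a : Fin 5 ↪o Fin n, Related (zeroWord a) w) ↔ IsExceptionalZero (opList w) := by
  constructor
  · rintro ⟨a, h⟩
    rw [← h.isExceptionalZero_iff, (hasPattern_zeroWord a).isExceptionalZero_iff]
    exact Or.inl (.mk (by decide) (by decide) (by decide))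
  · rintro (h | h)
    · exact h.exists_related
    · rw [← opList_verticalFlip] at h
      obtain ⟨a, ha⟩ := h.exists_related
      exact ⟨a, ha.trans _ _ _ (.symm _ _ (.rel _ _ ⟨_, .verticalFlip, rfl⟩))⟩

theorem exists_pairRelated_iff {u w : Comp n} :
    (∃ a : Fin 4 ↪o Fin n, PairRelated (leftWord a, rightWord a) (u, w)) ↔
      IsExceptionalPair (opList u) (opList w) := by
  constructor
  · rintro ⟨a, h⟩
    rw [← h.isExceptionalPair_iff,
      (hasPattern_leftWord a).isExceptionalPair_iff (hasPattern_rightWord a)]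
    exact Or.inl (Or.inl (.mk (by decide) (by decide)))
  · rintro ((h | h) | h)
    · exact h.exists_pairRelated
    · exact h.exists_pairRelated_swap
    · rw [← opList_verticalFlip, ← opList_verticalFlip] at h
      have hsupp : supp u = supp w := by
        rw [← supp_verticalFlip u, ← supp_verticalFlip w]
        exact h.elim IsQuartic.supp_eq fun h => h.supp_eq.symm
      obtain ⟨a, ha⟩ := h.elim IsQuartic.exists_pairRelated IsQuartic.exists_pairRelated_swap
      exact ⟨a, ha.trans _ _ _ (IsTransformation.verticalFlip.pairRelated hsupp).symm⟩

end Connectedness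

end QuantumBruhat

theorem mainTheorem10 (n : ℕ) :
    ((∀ w : QuantumBruhat.Comp n,
        QuantumBruhat.IsMinimalZero 4 w ↔
          ∃ a : Fin 5 ↪o Fin n, QuantumBruhat.Related (QuantumBruhat.zeroWord a) w) ∧
      (∀ a b : Fin 5 ↪o Fin n,
        QuantumBruhat.Related (QuantumBruhat.zeroWord a) (QuantumBruhat.zeroWord b))) ∧
    ((∀ u w : QuantumBruhat.Comp n,
        QuantumBruhat.IsMinimalNonzero 4 u w ↔
          ∃ a : Fin 4 ↪o Fin n,
            QuantumBruhat.PairRelated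
              (QuantumBruhat.leftWord a, QuantumBruhat.rightWord a) (u, w)) ∧
      (∀ a b : Fin 4 ↪o Fin n,
        QuantumBruhat.PairRelated
          (QuantumBruhat.leftWord a, QuantumBruhat.rightWord a)
          (QuantumBruhat.leftWord b, QuantumBruhat.rightWord b))) := by
  refine ⟨⟨fun w => ?_, QuantumBruhat.related_zeroWord⟩,
    ⟨fun u w => ?_, QuantumBruhat.pairRelated_leftWord_rightWord⟩⟩
  · rw [QuantumBruhat.isMinimalZero_iff, QuantumBruhat.exists_related_zeroWord_iff]
  · rw [QuantumBruhat.isMinimalNonzero_iff, QuantumBruhat.exists_pairRelated_iff]
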